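/- **Lemma 2.3 (Desjardins-type logarithmic interpolation).** Let $\mathbb{R}^2_+=\{x\in\mathbb{R}^2 : x_2>0\}$. For every real number $\hat\rho$ there is a constant $C=C(\hat\rho)>0$, depending only on $\hat\rho$, with the following property. Let $\rho:\mathbb{R}^2_+\to\mathbb{R}$ be measurable with $0\le\rho\le\hat\rho$ almost everywhere, and let $u=(u^1,u^2)\in H^1(\mathbb{R}^2_+;\mathbb{R}^2)$ satisfy the slip boundary condition $$(u^1,u^2)=(\partial_{x_2}u^1,\,0)\quad\text{on } x_2=0,$$ understood in the following weak sense: for $g=u^1-\partial_{x_2}u^1$ and for $g=u^2$, $$\lim_{h\to0^+}\frac1h\int_0^h\!\int_{\mathbb{R}} g(x_1,x_2)\,\psi(x_1)\,dx_1\,dx_2=0\qquad\text{for all }\psi\in C_c^\infty(\mathbb{R}).$$ Then $\sqrt\rho\,u\in L^4(\mathbb{R}^2_+)$ and $$\|\sqrt\rho\,u\|_{L^4}^2\le C(\hat\rho)\,\bigl(1+\|\sqrt\rho\,u\|_{L^2}\bigr)\,\|u\|_{H^1}\sqrt{\ln\bigl(2+\|u\|_{H^1}^2\bigr)},$$ where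 all norms are over $\mathbb{R}^2_+$ and $\|u\|_{H^1}^2=\|u\|_{L^2}^2+\sum_{i,j=1}^2\|\partial_{x_i}u^j\|_{L^2}^2$. -/

import Mathlib

open MeasureTheory Filter Topology
open scoped ContDiff

namespace HalfPlane

/-- The Euclidean plane; the coordinates `x₁`, `x₂` are `x 0`, `x 1`. -/
abbrev Plane : Type := EuclideanSpace ℝ (Fin 2)

/-- The open half-plane `{x : x₂ > 0}`. -/
def upperHalf : Set Plane := {x | 0 < x 1}

/-- Lebesgue measure on the open half-plane. -/
noncomputable def vol : Measure Plane := volume.restrict upperHalf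

/-- The `i`-th standard basis vector. -/
noncomputable def basisVec (i : Fin 2) : Plane := EuclideanSpace.single i 1

/-- `g` is a weak partial derivative `∂ᵢ f` on the open half-plane: both functions are locally
integrable there and `∫ f ∂ᵢφ = - ∫ g φ` for all `φ ∈ C_c^∞` of the open half-plane. -/
def HasWeakPartial (i : Fin 2) (f g : Plane → ℝ) : Prop :=
  LocallyIntegrableOn f upperHalf ∧ LocallyIntegrableOn g upperHalf ∧
    ∀ φ : Plane → ℝ, ContDiff ℝ ∞ φ → HasCompactSupport φ → tsupport φ ⊆ upperHalf →
      ∫ x, f x * fderiv ℝ φ x (basisVec i) ∂vol = - ∫ x, g x * φ x ∂vol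

/-- Weak partial derivatives are unique almost everywhere on the half-plane. -/
theorem HasWeakPartial.ae_eq {i : Fin 2} {f g₁ g₂ : Plane → ℝ}
    (h₁ : HasWeakPartial i f g₁) (h₂ : HasWeakPartial i f g₂) : g₁ =ᵐ[vol] g₂ := by
  have hopen : IsOpen upperHalf := isOpen_lt continuous_const (by fun_prop)
  have hint : ∀ g : Plane → ℝ, LocallyIntegrableOn g upperHalf → ∀ φ : Plane → ℝ, Continuous φ →
      HasCompactSupport φ → tsupport φ ⊆ upperHalf → Integrable (fun x => g x * φ x) vol := by
    intro g hg φ hφ hc hs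
    have h := (hg.integrableOn_compact_subset hs hc.isCompact).mul_continuousOn
      hφ.continuousOn hc.isCompact
    have h' : Integrable (fun x => g x * φ x) := by
      refine (integrableOn_iff_integrable_of_support_subset ?_).1 h
      intro x hx
      exact subset_tsupport φ (fun h0 => hx (by simp [h0]))
    exact h'.restrict
  have key : ∀ᵐ x ∂(volume : Measure Plane), x ∈ upperHalf → (g₁ x - g₂ x) = 0 := by
    refine hopen.ae_eq_zero_of_integral_contDiff_smul_eq_zero (h₁.2.1.sub h₂.2.1) ?_
    intro φ hφ hc hs
    have e := (h₁.2.2 φ hφ hc hs).symm.trans (h₂.2.2 φ hφ hc hs)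
    have e2 : ∫ x, (g₁ x * φ x - g₂ x * φ x) ∂vol = 0 := by
      rw [integral_sub (hint _ h₁.2.1 φ hφ.continuous hc hs)
        (hint _ h₂.2.1 φ hφ.continuous hc hs)]
      linarith
    rw [← e2, vol, setIntegral_eq_integral_of_forall_compl_eq_zero]
    · refine integral_congr_ae (ae_of_all _ fun x => ?_)
      simp only [smul_eq_mul]
      ring
    · intro x hx
      have : φ x = 0 := image_eq_zero_of_notMem_tsupport fun h => hx (hs h)
      simp [this]
  rw [vol]
  refine (ae_restrict_iff' hopen.measurableSet).2 ?_
  filter_upwards [key] with x hx hxu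
  linarith [hx hxu]

open Classical in
/-- The weak partial derivative `∂ᵢ f` on the half-plane (unique almost everywhere);
the zero function if there is none. -/
noncomputable def weakPartial (i : Fin 2) (f : Plane → ℝ) : Plane → ℝ :=
  if h : ∃ g, HasWeakPartial i f g then h.choose else 0

/-- The vector field `u` belongs to `H¹` of the half-plane. -/
def MemH1 (u : Plane → Plane) : Prop :=
  MemLp u 2 vol ∧
    ∀ i j : Fin 2, ∃ g, HasWeakPartial i (fun x => u x j) g ∧ MemLp g 2 vol

/-- The `Lᵖ` norm over the half-plane as a real number (meaningful for functions in `Lᵖ`). -/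
noncomputable def normLp {E : Type*} [NormedAddCommGroup E] (p : ENNReal) (f : Plane → E) : ℝ :=
  (eLpNorm f p vol).toReal

/-- The `H¹` norm `(‖u‖² + ∑ᵢⱼ ‖∂ᵢ uʲ‖²)^(1/2)` with `L²` norms over the half-plane. -/
noncomputable def normH1 (u : Plane → Plane) : ℝ :=
  Real.sqrt (normLp 2 u ^ 2 + ∑ i : Fin 2, ∑ j : Fin 2,
    normLp 2 (weakPartial i (fun x => u x j)) ^ 2)

/-- `g = 0` on the line `x₂ = 0`, in the sense of traces: the averages of `g` over the strips
`0 < x₂ < h` tend to `0`, as distributions in `x₁`, when `h → 0⁺`. For `g` continuous up to the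
boundary this says `g(x₁, 0) = 0` for all `x₁`; for `g ∈ H¹` it says that the trace vanishes. -/
def ZeroOnBoundary (g : Plane → ℝ) : Prop :=
  ∀ ψ : ℝ → ℝ, ContDiff ℝ ∞ ψ → HasCompactSupport ψ →
    Tendsto (fun h : ℝ => h⁻¹ * ∫ x in {x : Plane | 0 < x 1 ∧ x 1 < h}, g x * ψ (x 0))
      (𝓝[>] 0) (𝓝 0)

/-- The slip boundary condition `(u¹, u²) = (∂₂u¹, 0)` on the line `x₂ = 0`. -/
def SlipBoundary (u : Plane → Plane) : Prop :=
  ZeroOnBoundary (fun x => u x 0 - weakPartial 1 (fun y => u y 0) x) ∧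
    ZeroOnBoundary (fun x => u x 1)

end HalfPlane

/-! In two dimensions $H^1$ just fails to embed in $L^\infty$. What survives is exponential decay of
superlevel sets, and this costs only a logarithm. Fix $h>\|u\|_{H^1}$ and a height $t$ with $t^2\sim
h^2\ln(2+h^2)$. Where a component satisfies $|w|\le 2t$, one has $w^4\le 4t^2w^2$, and after
weighting by the bounded density this part costs at most a multiple of
$t^2\|\sqrt\rho\,u\|_{L^2}^2$. Elsewhere $w^4\le 16(|w|-t)_+^4$, and the integral of this excess is
at most a multiple of $h^2\ln(2+h^2)$.

The excess is controlled by the inequality $\int F^2\le\int|\partial_1F|\int|\partial_2F|$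
(`lintegral_sq_le_mul_lintegral_fderiv`). It needs no boundary values, since vertical integration
can start at infinity. Let $\mu(a)$ be the measure of $\{f>a\}$. Applied to a truncation of $f$
between heights $a$ and $a+\tau$, the inequality and Cauchy-Schwarz give $\mu(a+\tau)\le\mu(a)\cdot
4\tau^{-2}\int_{a<f\le a+\tau}|\nabla f|^2$ (`superlevel_step`). Successive layers are disjoint and
share one Dirichlet energy, so $x\le e^{x-1}$ turns the product over $N$ layers into a factor
$e^{-N/2}$ once $\tau$ is large enough (`superlevel_le_exp`, `superlevel_le_of_integral_le`). Taking
$N\sim 2\ln(2+h^2)$ makes this factor at most $(2+h^2)^{-1}$, which absorbs the surplus power of $h$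
in the excess bound.

All this is done for compactly supported $C^1$ functions on $\{x_2>\delta\}$, with constants
independent of $\delta$. Mollification, cutoff and Fatou's lemma carry it to $H^1$, and $\delta\to0$
recovers the half-plane. -/

namespace HalfPlane

/-! ### Coordinates and the Gagliardo-Nirenberg-Sobolev inequality on half-planes. -/

/-- The open half-plane `{x : x₂ > δ}`. -/
def shiftedHalf (δ : ℝ) : Set Plane := {x | δ < x 1}

theorem measurableSet_shiftedHalf (δ : ℝ) : MeasurableSet (shiftedHalf δ) :=
  (isOpen_lt continuous_const (by fun_prop)).measurableSet

/-- The point with coordinates `z.1`, `z.2`. -/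
noncomputable def ofPair (z : ℝ × ℝ) : Plane := !₂[z.1, z.2]

theorem measurePreserving_ofPair : MeasurePreserving ofPair := by
  have h1 := (volume_preserving_finTwoArrow ℝ).symm
  have h2 := PiLp.volume_preserving_toLp (Fin 2)
  exact h2.comp h1

theorem ofPair_eq (s t : ℝ) : ofPair (s, t) = s • basisVec 0 + t • basisVec 1 := by
  ext i
  fin_cases i <;> simp [ofPair, basisVec]

theorem eq_ofPair (x : Plane) : x = ofPair (x 0, x 1) := by
  ext i
  fin_cases i <;> simp [ofPair]

theorem contDiff_ofPair : ContDiff ℝ ∞ ofPair := by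
  have : ofPair = fun z : ℝ × ℝ => z.1 • basisVec 0 + z.2 • basisVec 1 :=
    funext fun z => ofPair_eq z.1 z.2
  rw [this]
  fun_prop

theorem isometry_ofPair_left (t : ℝ) : Isometry fun s : ℝ => ofPair (s, t) := by
  refine Isometry.of_dist_eq fun a b => ?_
  simp [ofPair, EuclideanSpace.dist_eq, Real.dist_eq, Real.sqrt_sq_eq_abs]

theorem isometry_ofPair_right (s : ℝ) : Isometry fun t : ℝ => ofPair (s, t) := by
  refine Isometry.of_dist_eq fun a b => ?_
  simp [ofPair, EuclideanSpace.dist_eq, Real.dist_eq, Real.sqrt_sq_eq_abs]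

theorem deriv_comp_ofPair_left {F : Plane → ℝ} (hF : ContDiff ℝ 1 F) (s t : ℝ) :
    deriv (fun r => F (ofPair (r, t))) s = fderiv ℝ F (ofPair (s, t)) (basisVec 0) := by
  have h1 : HasDerivAt (fun r => ofPair (r, t)) (basisVec 0) s := by
    simp only [ofPair_eq]
    simpa using ((hasDerivAt_id s).smul_const (basisVec 0)).add_const (t • basisVec 1)
  exact ((hF.differentiable (by norm_num) _).hasFDerivAt.comp_hasDerivAt s h1).deriv

theorem deriv_comp_ofPair_right {F : Plane → ℝ} (hF : ContDiff ℝ 1 F) (s t : ℝ) :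
    deriv (fun r => F (ofPair (s, r))) t = fderiv ℝ F (ofPair (s, t)) (basisVec 1) := by
  have h1 : HasDerivAt (fun r => ofPair (s, r)) (basisVec 1) t := by
    simp only [ofPair_eq]
    simpa using ((hasDerivAt_id t).smul_const (basisVec 1)).const_add (s • basisVec 0)
  exact ((hF.differentiable (by norm_num) _).hasFDerivAt.comp_hasDerivAt t h1).deriv

theorem enorm_le_lintegral_left {F : Plane → ℝ} (hF : ContDiff ℝ 1 F) (hc : HasCompactSupport F)
    (s t : ℝ) :
    ‖F (ofPair (s, t))‖ₑ ≤ ∫⁻ r, ‖fderiv ℝ F (ofPair (r, t)) (basisVec 0)‖ₑ := by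
  have h1 : ContDiff ℝ 1 fun r => F (ofPair (r, t)) :=
    hF.comp ((contDiff_ofPair.of_le (by simp)).comp (by fun_prop))
  have h2 : HasCompactSupport fun r => F (ofPair (r, t)) :=
    hc.comp_isClosedEmbedding (isometry_ofPair_left t).isClosedEmbedding
  have h3 := h2.enorm_le_lintegral_Ici_deriv h1 s
  simp only [deriv_comp_ofPair_left hF] at h3
  exact h3.trans (setLIntegral_le_lintegral _ _)

/-- The reflection $y\mapsto -y$ of the one-sided estimate. Integrating down from $+\infty$ keeps
vertical rays inside the half-plane. -/
theorem _root_.HasCompactSupport.enorm_le_lintegral_Ioi_deriv {f : ℝ → ℝ} (hf : ContDiff ℝ 1 f)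
    (hc : HasCompactSupport f) (x : ℝ) : ‖f x‖ₑ ≤ ∫⁻ y in Set.Ioi x, ‖deriv f y‖ₑ := by
  have h1 : ContDiff ℝ 1 fun r => f (-r) := hf.comp contDiff_neg
  have h2 : HasCompactSupport fun r => f (-r) :=
    hc.comp_homeomorph (Homeomorph.neg ℝ)
  have h3 := h2.enorm_le_lintegral_Ici_deriv h1 (-x)
  simp only [neg_neg] at h3
  refine h3.trans (le_of_eq ?_)
  rw [setLIntegral_congr (Ioi_ae_eq_Ici (a := x)),
    ← (Measure.measurePreserving_neg (volume : Measure ℝ)).setLIntegral_comp_preimage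
    measurableSet_Ici (by fun_prop)]
  simp only [deriv_comp_neg, Set.preimage, Set.mem_Ici, le_neg, enorm_neg]
  rfl

theorem enorm_le_lintegral_right {F : Plane → ℝ} (hF : ContDiff ℝ 1 F) (hc : HasCompactSupport F)
    {δ s t : ℝ} (ht : δ < t) :
    ‖F (ofPair (s, t))‖ₑ ≤
      ∫⁻ r in Set.Ioi δ, ‖fderiv ℝ F (ofPair (s, r)) (basisVec 1)‖ₑ := by
  have h1 : ContDiff ℝ 1 fun r => F (ofPair (s, r)) :=
    hF.comp ((contDiff_ofPair.of_le (by simp)).comp (by fun_prop))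
  have h2 : HasCompactSupport fun r => F (ofPair (s, r)) :=
    hc.comp_isClosedEmbedding (isometry_ofPair_right s).isClosedEmbedding
  have h3 := HasCompactSupport.enorm_le_lintegral_Ioi_deriv h1 h2 t
  simp only [deriv_comp_ofPair_right hF] at h3
  exact h3.trans (lintegral_mono_set (Set.Ioi_subset_Ioi ht.le))

theorem setLIntegral_shiftedHalf {h : Plane → ENNReal} (hh : Measurable h) (δ : ℝ) :
    ∫⁻ x in shiftedHalf δ, h x =
      ∫⁻ z, h (ofPair z) ∂((volume : Measure ℝ).prod (volume.restrict (Set.Ioi δ))) := by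
  rw [← measurePreserving_ofPair.setLIntegral_comp_preimage (measurableSet_shiftedHalf δ) hh]
  have : ofPair ⁻¹' shiftedHalf δ = Set.univ ×ˢ Set.Ioi δ := by
    ext z
    simp [shiftedHalf, ofPair]
  rw [this, Measure.volume_eq_prod, ← Measure.prod_restrict, Measure.restrict_univ]

/-- The Gagliardo-Nirenberg-Sobolev inequality on a half-plane. -/
theorem lintegral_sq_le_mul_lintegral_fderiv {F : Plane → ℝ} (hF : ContDiff ℝ 1 F)
    (hc : HasCompactSupport F) (δ : ℝ) :
    ∫⁻ x in shiftedHalf δ, ‖F x‖ₑ ^ 2 ≤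
      (∫⁻ x in shiftedHalf δ, ‖fderiv ℝ F x (basisVec 0)‖ₑ) *
        ∫⁻ x in shiftedHalf δ, ‖fderiv ℝ F x (basisVec 1)‖ₑ := by
  have hcF := hF.continuous
  have hcd : ∀ i, Continuous fun x => fderiv ℝ F x (basisVec i) := fun i =>
    (hF.continuous_fderiv (by norm_num)).clm_apply continuous_const
  have hcp : Continuous ofPair := contDiff_ofPair.continuous
  have hm : ∀ i, Measurable fun x => ‖fderiv ℝ F x (basisVec i)‖ₑ := fun i =>
    (hcd i).enorm.measurable
  have hmp : ∀ i, Measurable fun z => ‖fderiv ℝ F (ofPair z) (basisVec i)‖ₑ := fun i =>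
    (hm i).comp hcp.measurable
  rw [setLIntegral_shiftedHalf (hcF.enorm.measurable.pow_const 2), setLIntegral_shiftedHalf (hm 0),
    setLIntegral_shiftedHalf (hm 1), lintegral_prod_symm _ (hmp 0).aemeasurable,
    lintegral_prod _ (hmp 1).aemeasurable, mul_comm,
    ← lintegral_prod_mul (hmp 1).lintegral_prod_right'.aemeasurable
      (hmp 0).lintegral_prod_left'.aemeasurable]
  have hae : ∀ᵐ z ∂((volume : Measure ℝ).prod (volume.restrict (Set.Ioi δ))), δ < z.2 := by
    have h : ∀ᵐ t ∂((volume : Measure ℝ).restrict (Set.Ioi δ)), δ < t :=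
      ae_restrict_mem measurableSet_Ioi
    exact Measure.quasiMeasurePreserving_snd.ae h
  -- After Fubini and Tonelli the right side is one integral of (vertical integral at $z_1$) times
  -- (horizontal integral at $z_2$); each factor dominates $|F(z)|$.
  refine lintegral_mono_ae ?_
  filter_upwards [hae] with z hz
  rw [sq]
  exact mul_le_mul' (enorm_le_lintegral_right hF hc hz) (enorm_le_lintegral_left hF hc z.1 z.2)

end HalfPlane

/-! ### Smooth truncation and Cauchy-Schwarz. -/

/-- Squared positive parts are the building blocks of $C^1$ truncations, so the classical chain rule
suffices throughout. At $0$ the derivative is the limit of the derivatives nearby. -/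
theorem hasDerivAt_max_zero_sq (s : ℝ) :
    HasDerivAt (fun t : ℝ => max t 0 ^ 2) (2 * max s 0) s := by
  have key : ∀ y : ℝ, y ≠ 0 → HasDerivAt (fun t : ℝ => max t 0 ^ 2) (2 * max y 0) y := by
    intro y hy
    rcases lt_or_gt_of_ne hy with h | h
    · rw [max_eq_right h.le]
      refine HasDerivAt.congr_of_eventuallyEq (f := fun _ => (0 : ℝ)) ?_ ?_
      · simpa using hasDerivAt_const y (0 : ℝ)
      · filter_upwards [Iio_mem_nhds h] with t ht
        simp [max_eq_right (le_of_lt (Set.mem_Iio.1 ht))]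
    · rw [max_eq_left h.le]
      refine HasDerivAt.congr_of_eventuallyEq (f := fun t => t ^ 2) ?_ ?_
      · simpa using hasDerivAt_pow 2 y
      · filter_upwards [Ioi_mem_nhds h] with t ht
        simp [max_eq_left (le_of_lt (Set.mem_Ioi.1 ht))]
  by_cases hs : s = 0
  · subst hs
    refine hasDerivAt_of_hasDerivAt_of_ne (g := fun y => 2 * max y 0) key ?_ ?_
    · exact Continuous.continuousAt (by fun_prop)
    · exact Continuous.continuousAt (by fun_prop)
  · exact key s hs

theorem sq_integral_mul_le {α : Type*} {m : MeasurableSpace α} {μ : Measure α} {a b : α → ℝ}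
    (ha : ∀ x, 0 ≤ a x) (hb : ∀ x, 0 ≤ b x) (ha2 : MemLp a 2 μ) (hb2 : MemLp b 2 μ) :
    (∫ x, a x * b x ∂μ) ^ 2 ≤ (∫ x, a x ^ 2 ∂μ) * ∫ x, b x ^ 2 ∂μ := by
  have h := integral_mul_le_Lp_mul_Lq_of_nonneg (μ := μ) Real.HolderConjugate.two_two
    (ae_of_all _ ha) (ae_of_all _ hb) (by simpa using ha2) (by simpa using hb2)
  simp only [Real.rpow_two, ← Real.sqrt_eq_rpow] at h
  have h0 : 0 ≤ ∫ x, a x * b x ∂μ := integral_nonneg fun x => mul_nonneg (ha x) (hb x)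
  calc (∫ x, a x * b x ∂μ) ^ 2
      ≤ (√(∫ x, a x ^ 2 ∂μ) * √(∫ x, b x ^ 2 ∂μ)) ^ 2 := by gcongr
    _ = _ := by
      rw [mul_pow, Real.sq_sqrt (integral_nonneg fun x => by positivity),
        Real.sq_sqrt (integral_nonneg fun x => by positivity)]

theorem Continuous.integrable_pow_of_hasCompactSupport {g : HalfPlane.Plane → ℝ}
    (hg : Continuous g) (hc : HasCompactSupport g) {n : ℕ} (hn : n ≠ 0)
    (μ : Measure HalfPlane.Plane) [IsFiniteMeasureOnCompacts μ] :
    Integrable (fun x => g x ^ n) μ := by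
  have h1 : Continuous fun x => g x ^ n := by fun_prop
  have h2 : HasCompactSupport fun x => g x ^ n :=
    HasCompactSupport.comp_left (g := fun t : ℝ => t ^ n) hc (zero_pow hn)
  exact h1.integrable_of_hasCompactSupport h2

/-! ### Decay of superlevel sets and the excess over a level. -/

namespace HalfPlane

theorem norm_basisVec (i : Fin 2) : ‖basisVec i‖ = 1 := by simp [basisVec]

theorem _root_.HasCompactSupport.fderiv_norm {f : Plane → ℝ} (hc : HasCompactSupport f) :
    HasCompactSupport fun x => ‖fderiv ℝ f x‖ :=
  (hc.fderiv (𝕜 := ℝ)).norm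

theorem continuous_norm_fderiv {f : Plane → ℝ} (hf : ContDiff ℝ 1 f) :
    Continuous fun x => ‖fderiv ℝ f x‖ :=
  (hf.continuous_fderiv (by norm_num)).norm

theorem integrable_norm_fderiv_sq {f : Plane → ℝ} (hf : ContDiff ℝ 1 f)
    (hc : HasCompactSupport f) (μ : Measure Plane) [IsFiniteMeasureOnCompacts μ] :
    Integrable (fun x => ‖fderiv ℝ f x‖ ^ 2) μ :=
  (continuous_norm_fderiv hf).integrable_pow_of_hasCompactSupport hc.fderiv_norm two_ne_zero μ

/-- The Gagliardo-Nirenberg-Sobolev inequality for a `C¹` function `Φ ∘ f` of a compactly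
supported function. -/
theorem integral_comp_sq_le {f : Plane → ℝ} (hf : ContDiff ℝ 1 f) (hc : HasCompactSupport f)
    {Φ φ : ℝ → ℝ} (hΦ : ∀ s, HasDerivAt Φ (φ s) s) (hφ : Continuous φ) (h0 : Φ 0 = 0) (δ : ℝ) :
    ∫ x in shiftedHalf δ, Φ (f x) ^ 2 ≤
      (∫ x in shiftedHalf δ, |φ (f x)| * ‖fderiv ℝ f x‖) ^ 2 := by
  have hder : deriv Φ = φ := funext fun s => (hΦ s).deriv
  have hΦ1 : ContDiff ℝ 1 Φ :=
    contDiff_one_iff_deriv.2 ⟨fun s => (hΦ s).differentiableAt, by rwa [hder]⟩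
  have hF : ContDiff ℝ 1 fun x => Φ (f x) := hΦ1.comp hf
  have hFc : HasCompactSupport fun x => Φ (f x) := hc.comp_left h0
  have key := lintegral_sq_le_mul_lintegral_fderiv hF hFc δ
  have hfd : ∀ i x, ‖fderiv ℝ (fun x => Φ (f x)) x (basisVec i)‖ₑ ≤
      ENNReal.ofReal (|φ (f x)| * ‖fderiv ℝ f x‖) := by
    intro i x
    have : HasFDerivAt (fun x => Φ (f x)) (φ (f x) • fderiv ℝ f x) x :=
      (hΦ (f x)).comp_hasFDerivAt x (hf.differentiable (by norm_num) x).hasFDerivAt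
    rw [this.fderiv, ← ofReal_norm]
    refine ENNReal.ofReal_le_ofReal ?_
    simp only [smul_apply, smul_eq_mul, norm_mul, Real.norm_eq_abs]
    gcongr
    simpa [norm_basisVec] using (fderiv ℝ f x).le_opNorm (basisVec i)
  have hi1 : Integrable (fun x => Φ (f x) ^ 2) (volume.restrict (shiftedHalf δ)) :=
    hF.continuous.integrable_pow_of_hasCompactSupport hFc two_ne_zero _
  have hi2 : Integrable (fun x => |φ (f x)| * ‖fderiv ℝ f x‖) (volume.restrict (shiftedHalf δ)) :=
    ((hφ.comp hf.continuous).abs.mul (continuous_norm_fderiv hf)).integrable_of_hasCompactSupport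
      hc.fderiv_norm.mul_left
  have hn : 0 ≤ ∫ x in shiftedHalf δ, |φ (f x)| * ‖fderiv ℝ f x‖ :=
    integral_nonneg fun x => by positivity
  rw [← ENNReal.ofReal_le_ofReal_iff (by positivity), sq (∫ x in shiftedHalf δ, _),
    ENNReal.ofReal_mul hn, ofReal_integral_eq_lintegral_ofReal hi1
      (ae_of_all _ fun x => by positivity),
    ofReal_integral_eq_lintegral_ofReal hi2 (ae_of_all _ fun x => by positivity)]
  refine le_trans (le_of_eq ?_) (key.trans (mul_le_mul' (lintegral_mono (hfd 0))
    (lintegral_mono (hfd 1))))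
  refine lintegral_congr fun x => ?_
  rw [← ofReal_norm, ← ENNReal.ofReal_pow (norm_nonneg _), Real.norm_eq_abs, sq_abs]

/-- The measure of the superlevel set `{f > c}` in the half-plane `{x₂ > δ}`. -/
noncomputable def superlevel (δ : ℝ) (f : Plane → ℝ) (c : ℝ) : ℝ :=
  (volume.restrict (shiftedHalf δ)).real {x | c < f x}

theorem superlevel_nonneg (δ : ℝ) (f : Plane → ℝ) (c : ℝ) : 0 ≤ superlevel δ f c :=
  measureReal_nonneg

theorem measure_superlevel_ne_top {f : Plane → ℝ} (hc : HasCompactSupport f) (δ : ℝ) {c : ℝ}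
    (h0 : 0 ≤ c) : (volume.restrict (shiftedHalf δ)) {x | c < f x} ≠ ⊤ := by
  refine ne_top_of_le_ne_top hc.isCompact.measure_lt_top.ne (measure_mono fun x hx => ?_)
  exact subset_tsupport f (h0.trans_lt hx).ne'

theorem mul_superlevel_le_integral {f g : Plane → ℝ} (hf : Continuous f)
    (hc : HasCompactSupport f) {δ c r : ℝ} (h0 : 0 ≤ c) (hr : ∀ x, c < f x → r ≤ g x)
    (hg0 : ∀ x, 0 ≤ g x) (hg : Integrable g (volume.restrict (shiftedHalf δ))) :
    r * superlevel δ f c ≤ ∫ x in shiftedHalf δ, g x := by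
  have hm : MeasurableSet {x | c < f x} := (isOpen_lt continuous_const hf).measurableSet
  calc r * superlevel δ f c
      = ∫ x in {x | c < f x}, r ∂(volume.restrict (shiftedHalf δ)) := by
        rw [setIntegral_const, smul_eq_mul, mul_comm]; rfl
    _ ≤ ∫ x in {x | c < f x}, g x ∂(volume.restrict (shiftedHalf δ)) := by
        refine setIntegral_mono_on ?_ hg.integrableOn hm hr
        exact integrableOn_const (measure_superlevel_ne_top hc δ h0)
    _ ≤ _ := setIntegral_le_integral hg (ae_of_all _ hg0)

/-- Truncate $f$ to the layer $a<f\le a+\tau$. Chebyshev bounds the $L^2$ norm of the truncation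
from below, the Sobolev inequality bounds it above by $\int_E|\nabla f|$, and Cauchy-Schwarz on the
layer $E$ produces the factor $|E|\le\mu(a)$. -/
theorem superlevel_step {f : Plane → ℝ} (hf : ContDiff ℝ 1 f) (hc : HasCompactSupport f)
    (δ : ℝ) {a τ : ℝ} (ha : 0 ≤ a) (hτ : 0 < τ) :
    superlevel δ f (a + τ) ≤ superlevel δ f a *
      (4 / τ ^ 2 * ∫ x in {x | a < f x ∧ f x ≤ a + τ}, ‖fderiv ℝ f x‖ ^ 2
        ∂(volume.restrict (shiftedHalf δ))) := by
  set ν := volume.restrict (shiftedHalf δ) with hν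
  set E := {x | a < f x ∧ f x ≤ a + τ} with hE
  have hEm : MeasurableSet E :=
    ((isOpen_lt continuous_const hf.continuous).measurableSet).inter
      (isClosed_le hf.continuous continuous_const).measurableSet
  -- The derivative of `Φ` is the tent of height $1$ on $[a,a+\tau]$ with peak at the midpoint.
  -- Hence `Φ` vanishes below $a$ and is constant, equal to the tent's area $\tau/2$, above
  -- $a+\tau$.
  let Φ : ℝ → ℝ := fun s =>
    (max (s - a) 0 ^ 2 - 2 * max (s - (a + τ / 2)) 0 ^ 2 + max (s - (a + τ)) 0 ^ 2) / τ
  let φ : ℝ → ℝ := fun s =>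
    (2 * max (s - a) 0 - 2 * (2 * max (s - (a + τ / 2)) 0) + 2 * max (s - (a + τ)) 0) / τ
  have hΦ : ∀ s, HasDerivAt Φ (φ s) s := fun s =>
    ((((hasDerivAt_max_zero_sq (s - a)).comp_sub_const s a).sub
      (((hasDerivAt_max_zero_sq (s - (a + τ / 2))).comp_sub_const s (a + τ / 2)).const_mul 2)).add
      ((hasDerivAt_max_zero_sq (s - (a + τ))).comp_sub_const s (a + τ))).div_const τ
  have hφ : Continuous φ := by fun_prop
  have hΦc : Continuous Φ := continuous_iff_continuousAt.2 fun s => (hΦ s).continuousAt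
  have hΦ0 : Φ 0 = 0 := by
    have h1 : (0 : ℝ) - a ≤ 0 := by linarith
    have h2 : (0 : ℝ) - (a + τ / 2) ≤ 0 := by linarith
    have h3 : (0 : ℝ) - (a + τ) ≤ 0 := by linarith
    simp only [Φ, max_eq_right h1, max_eq_right h2, max_eq_right h3]
    simp
  have hΦtop : ∀ s, a + τ < s → Φ s = τ / 2 := by
    intro s hs
    have h1 : 0 ≤ s - a := by linarith
    have h2 : 0 ≤ s - (a + τ / 2) := by linarith
    have h3 : 0 ≤ s - (a + τ) := by linarith
    simp only [Φ, max_eq_left h1, max_eq_left h2, max_eq_left h3]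
    field_simp
    ring
  have hφle : ∀ s, |φ s| ≤ Set.indicator (Set.Ioc a (a + τ)) 1 s := by
    intro s
    by_cases hs : s ∈ Set.Ioc a (a + τ)
    · rw [Set.indicator_of_mem hs, Pi.one_apply, abs_le]
      have h1 : 0 ≤ s - a := by linarith [hs.1]
      have h3 : s - (a + τ) ≤ 0 := by linarith [hs.2]
      simp only [φ, max_eq_left h1, max_eq_right h3]
      rw [le_div_iff₀ hτ, div_le_iff₀ hτ]
      rcases le_total 0 (s - (a + τ / 2)) with h | h
      · rw [max_eq_left h]
        constructor <;> linarith [hs.1, hs.2]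
      · rw [max_eq_right h]
        constructor <;> linarith [hs.1, hs.2]
    · rw [Set.indicator_of_notMem hs]
      refine le_of_eq (abs_eq_zero.2 ?_)
      rcases le_or_gt s a with h | h
      · have h1 : s - a ≤ 0 := by linarith
        have h2 : s - (a + τ / 2) ≤ 0 := by linarith
        have h3 : s - (a + τ) ≤ 0 := by linarith
        simp only [φ, max_eq_right h1, max_eq_right h2, max_eq_right h3]
        simp
      · have hs' : a + τ < s := not_le.1 fun h' => hs ⟨h, h'⟩
        have h1 : 0 ≤ s - a := by linarith
        have h2 : 0 ≤ s - (a + τ / 2) := by linarith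
        have h3 : 0 ≤ s - (a + τ) := by linarith
        simp only [φ, max_eq_left h1, max_eq_left h2, max_eq_left h3]
        field_simp
        ring
  have hEfin : ν E ≠ ⊤ := by
    refine ne_top_of_le_ne_top (measure_superlevel_ne_top hc δ ha) (measure_mono fun x hx => ?_)
    exact hx.1
  have hp2 := integrable_norm_fderiv_sq hf hc ν
  have hpL : MemLp (fun x => ‖fderiv ℝ f x‖) 2 (ν.restrict E) :=
    ((memLp_two_iff_integrable_sq (continuous_norm_fderiv hf).aestronglyMeasurable).2
      hp2).restrict E
  have hind : ∫ x, |φ (f x)| * ‖fderiv ℝ f x‖ ∂ν ≤ ∫ x in E, 1 * ‖fderiv ℝ f x‖ ∂ν := by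
    rw [← integral_indicator hEm]
    have hint : Integrable (fun x => |φ (f x)| * ‖fderiv ℝ f x‖) ν :=
      ((hφ.comp hf.continuous).abs.mul
        (continuous_norm_fderiv hf)).integrable_of_hasCompactSupport hc.fderiv_norm.mul_left
    have hint2 : Integrable (E.indicator fun x => 1 * ‖fderiv ℝ f x‖) ν := by
      refine Integrable.indicator ?_ hEm
      simpa using (continuous_norm_fderiv hf).integrable_of_hasCompactSupport hc.fderiv_norm
    refine integral_mono hint hint2 fun x => ?_
    have := hφle (f x)
    by_cases hx : x ∈ E
    · rw [Set.indicator_of_mem (show f x ∈ Set.Ioc a (a + τ) from hx)] at this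
      rw [Set.indicator_of_mem hx]
      exact mul_le_mul_of_nonneg_right this (norm_nonneg _)
    · rw [Set.indicator_of_notMem (show f x ∉ Set.Ioc a (a + τ) from hx)] at this
      rw [Set.indicator_of_notMem hx]
      exact mul_nonpos_of_nonpos_of_nonneg this (norm_nonneg _)
  have hfin : IsFiniteMeasure (ν.restrict E) := ⟨by
    rw [Measure.restrict_apply_univ]; exact hEfin.lt_top⟩
  have hcs := sq_integral_mul_le (μ := ν.restrict E) (a := fun _ => 1)
    (b := fun x => ‖fderiv ℝ f x‖) (fun _ => zero_le_one) (fun _ => norm_nonneg _)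
    (memLp_const 1) hpL
  have hE1 : ∫ x in E, (1 : ℝ) ^ 2 ∂ν ≤ superlevel δ f a := by
    rw [one_pow, setIntegral_const, smul_eq_mul, mul_one]
    exact measureReal_mono (fun x hx => hx.1) (measure_superlevel_ne_top hc δ ha)
  have hsob := integral_comp_sq_le hf hc hΦ hφ hΦ0 δ
  have hcheb := mul_superlevel_le_integral (δ := δ) (r := (τ / 2) ^ 2)
    (g := fun x => Φ (f x) ^ 2) hf.continuous hc
    (by positivity : 0 ≤ a + τ) (fun x hx => by simp only [hΦtop _ hx]; exact le_rfl)
    (fun x => by positivity)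
    ((hΦc.comp hf.continuous).integrable_pow_of_hasCompactSupport (hc.comp_left hΦ0)
      two_ne_zero _)
  have hn : 0 ≤ ∫ x, |φ (f x)| * ‖fderiv ℝ f x‖ ∂ν := integral_nonneg fun x => by positivity
  have hI : 0 ≤ ∫ x in E, ‖fderiv ℝ f x‖ ^ 2 ∂ν := integral_nonneg fun x => by positivity
  have hfinal : (τ / 2) ^ 2 * superlevel δ f (a + τ) ≤
      superlevel δ f a * ∫ x in E, ‖fderiv ℝ f x‖ ^ 2 ∂ν :=
    calc _ ≤ _ := hcheb
      _ ≤ _ := hsob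
      _ ≤ _ := pow_le_pow_left₀ hn hind 2
      _ ≤ _ := hcs
      _ ≤ _ := mul_le_mul_of_nonneg_right hE1 hI
  rw [show superlevel δ f a * (4 / τ ^ 2 * ∫ x in E, ‖fderiv ℝ f x‖ ^ 2 ∂ν) =
    (superlevel δ f a * ∫ x in E, ‖fderiv ℝ f x‖ ^ 2 ∂ν) / (τ / 2) ^ 2 by field_simp; ring]
  rw [le_div_iff₀ (by positivity)]
  linarith

/-- Iteration of the one-layer estimate. Since the layers are disjoint, only their total energy
enters, however it is distributed among them. -/
theorem superlevel_le_exp {f : Plane → ℝ} (hf : ContDiff ℝ 1 f) (hc : HasCompactSupport f)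
    (δ : ℝ) {l τ : ℝ} (hl : 0 ≤ l) (hτ : 0 < τ) (k : ℕ) :
    superlevel δ f (l + k * τ) ≤ superlevel δ f l *
      Real.exp (4 / τ ^ 2 * (∫ x in {x | l < f x ∧ f x ≤ l + k * τ}, ‖fderiv ℝ f x‖ ^ 2
        ∂(volume.restrict (shiftedHalf δ))) - k) := by
  induction k with
  | zero =>
    have : {x | l < f x ∧ f x ≤ l + ((0 : ℕ) : ℝ) * τ} = ∅ := by
      ext x
      simp
    rw [this]
    simp
  | succ k ih =>
    have hk : 0 ≤ (k : ℝ) * τ := by positivity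
    have h := superlevel_step hf hc δ (a := l + k * τ) (by positivity) hτ
    set I := ∫ x in {x | l < f x ∧ f x ≤ l + k * τ}, ‖fderiv ℝ f x‖ ^ 2
        ∂(volume.restrict (shiftedHalf δ))
    set J := ∫ x in {x | l + k * τ < f x ∧ f x ≤ l + k * τ + τ}, ‖fderiv ℝ f x‖ ^ 2
        ∂(volume.restrict (shiftedHalf δ)) with hJ
    have hadd : ∫ x in {x | l < f x ∧ f x ≤ l + (k + 1 : ℕ) * τ}, ‖fderiv ℝ f x‖ ^ 2
        ∂(volume.restrict (shiftedHalf δ)) = I + J := by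
      have hp2 := integrable_norm_fderiv_sq hf hc (volume.restrict (shiftedHalf δ))
      rw [← setIntegral_union _ _ hp2.integrableOn hp2.integrableOn]
      · congr 2
        ext x
        simp only [Set.mem_ofPred_eq, Set.mem_union]
        push_cast
        constructor
        · rintro ⟨h1, h2⟩
          rcases le_or_gt (f x) (l + k * τ) with h3 | h3
          · exact Or.inl ⟨h1, h3⟩
          · exact Or.inr ⟨h3, by linarith⟩
        · rintro (⟨h1, h2⟩ | ⟨h1, h2⟩)
          · exact ⟨h1, by linarith⟩
          · exact ⟨by linarith, by linarith⟩
      · rw [Set.disjoint_left]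
        rintro x ⟨_, h1⟩ ⟨h2, _⟩
        linarith
      · exact ((isOpen_lt continuous_const hf.continuous).measurableSet).inter
          (isClosed_le hf.continuous continuous_const).measurableSet
    -- The inequality $x\le e^{x-1}$ converts a product of layer energies into the exponential of
    -- their sum, gaining $e^{-1}$ per layer.
    have he : 4 / τ ^ 2 * J ≤ Real.exp (4 / τ ^ 2 * J - 1) := by
      linarith [Real.add_one_le_exp (4 / τ ^ 2 * J - 1)]
    have hJ0 : 0 ≤ 4 / τ ^ 2 * J := by
      have : 0 ≤ J := integral_nonneg fun x => by positivity
      positivity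
    rw [hadd]
    calc superlevel δ f (l + (k + 1 : ℕ) * τ) = superlevel δ f (l + k * τ + τ) := by
          congr 1; push_cast; ring
      _ ≤ _ := h
      _ ≤ (superlevel δ f l * Real.exp (4 / τ ^ 2 * I - k)) *
          Real.exp (4 / τ ^ 2 * J - 1) :=
        mul_le_mul ih he hJ0 (mul_nonneg (superlevel_nonneg _ _ _) (Real.exp_pos _).le)
      _ = _ := by
        rw [mul_assoc, ← Real.exp_add]
        congr 2
        push_cast
        ring

/-- Gaussian decay of superlevel sets. -/
theorem superlevel_le_of_integral_le {f : Plane → ℝ} (hf : ContDiff ℝ 1 f)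
    (hc : HasCompactSupport f) {δ D M t : ℝ} (ht : 0 < t) {N : ℕ} (hN : 1 ≤ N)
    (hD : ∫ x in shiftedHalf δ, ‖fderiv ℝ f x‖ ^ 2 ≤ D)
    (hM : ∫ x in shiftedHalf δ, f x ^ 2 ≤ M) (hNt : 32 * D * N ≤ t ^ 2) :
    superlevel δ f t ≤ 4 * M / t ^ 2 * Real.exp (-(N / 2)) := by
  have hN0 : (0 : ℝ) < N := by exact_mod_cast hN
  -- Starting at $t/2$ leaves room for Chebyshev to bound the initial measure by $4M/t^2$; $N$ steps
  -- of length $t/(2N)$ then end exactly at $t$.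
  have h := superlevel_le_exp hf hc δ (l := t / 2) (τ := t / (2 * N)) (by positivity)
    (by positivity) N
  rw [show t / 2 + N * (t / (2 * N)) = t by field_simp; ring] at h
  have hl : (t / 2) ^ 2 * superlevel δ f (t / 2) ≤ M := by
    refine (mul_superlevel_le_integral hf.continuous hc (by positivity) (fun x hx => ?_)
      (fun x => sq_nonneg _) ?_).trans hM
    · exact pow_le_pow_left₀ (by positivity) hx.le 2
    · exact hf.continuous.integrable_pow_of_hasCompactSupport hc two_ne_zero _
  have hl' : superlevel δ f (t / 2) ≤ 4 * M / t ^ 2 := by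
    rw [le_div_iff₀ (by positivity)]
    linarith
  have hI : ∫ x in {x | t / 2 < f x ∧ f x ≤ t}, ‖fderiv ℝ f x‖ ^ 2
      ∂(volume.restrict (shiftedHalf δ)) ≤ D :=
    (setIntegral_le_integral (integrable_norm_fderiv_sq hf hc _)
      (ae_of_all _ fun x => by positivity)).trans hD
  refine h.trans (mul_le_mul hl' (Real.exp_le_exp.2 ?_) (Real.exp_pos _).le
    ((superlevel_nonneg _ _ _).trans hl'))
  -- The constant $32$ in `hNt` makes the energy consume at most half of the gain $N$.
  have h1 : 4 / (t / (2 * N)) ^ 2 * D ≤ N / 2 := by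
    rw [show 4 / (t / (2 * N)) ^ 2 * D = 16 * N ^ 2 * D / t ^ 2 by field_simp; ring,
      div_le_iff₀ (by positivity)]
    nlinarith
  have h2 := mul_le_mul_of_nonneg_left hI (by positivity : 0 ≤ 4 / (t / (2 * N)) ^ 2)
  linarith

/-- The fourth power of the excess over a level is controlled by the superlevel set. -/
theorem integral_excess_pow_four_le {f : Plane → ℝ} (hf : ContDiff ℝ 1 f)
    (hc : HasCompactSupport f) {δ D t : ℝ} (ht : 0 ≤ t)
    (hD : ∫ x in shiftedHalf δ, ‖fderiv ℝ f x‖ ^ 2 ≤ D) :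
    ∫ x in shiftedHalf δ, max (f x - t) 0 ^ 4 ≤ 16 * D ^ 2 * superlevel δ f t := by
  set ν := volume.restrict (shiftedHalf δ) with hν
  set g : Plane → ℝ := fun x => max (f x - t) 0 with hg
  have h00 : max (0 - t) 0 = 0 := max_eq_right (by linarith)
  have hgc : Continuous g := by have := hf.continuous; fun_prop
  have hgs : HasCompactSupport g := hc.comp_left (g := fun s => max (s - t) 0) h00
  have hg0 : ∀ x, 0 ≤ g x := fun x => le_max_right _ _
  have hgi : ∀ n : ℕ, n ≠ 0 → Integrable (fun x => g x ^ n) ν := fun n hn =>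
    hgc.integrable_pow_of_hasCompactSupport hgs hn ν
  have hD0 : 0 ≤ ∫ x, ‖fderiv ℝ f x‖ ^ 2 ∂ν := integral_nonneg fun x => by positivity
  have hsob := integral_comp_sq_le hf hc (Φ := fun s => max (s - t) 0 ^ 2)
    (φ := fun s => 2 * max (s - t) 0)
    (fun s => (hasDerivAt_max_zero_sq (s - t)).comp_sub_const s t) (by fun_prop)
    (by simp only [h00]; norm_num) δ
  have hpL : MemLp (fun x => ‖fderiv ℝ f x‖) 2 ν :=
    (memLp_two_iff_integrable_sq (continuous_norm_fderiv hf).aestronglyMeasurable).2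
      (integrable_norm_fderiv_sq hf hc ν)
  have hgL : MemLp g 2 ν :=
    (memLp_two_iff_integrable_sq hgc.aestronglyMeasurable).2 (hgi 2 two_ne_zero)
  have hcs1 := sq_integral_mul_le hg0 (fun x => norm_nonneg (fderiv ℝ f x)) hgL hpL
  -- The Sobolev inequality for $g^2$, whose gradient is bounded by $2g|\nabla f|$, followed by
  -- Cauchy-Schwarz.
  have h1 : ∫ x, g x ^ 4 ∂ν ≤ 4 * (∫ x, g x ^ 2 ∂ν) * D := by
    have e1 : ∫ x, g x ^ 4 ∂ν = ∫ x, (max (f x - t) 0 ^ 2) ^ 2 ∂ν :=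
      integral_congr_ae (ae_of_all _ fun x => by simp only [g]; ring)
    have e2 : ∫ x, |2 * max (f x - t) 0| * ‖fderiv ℝ f x‖ ∂ν =
        2 * ∫ x, g x * ‖fderiv ℝ f x‖ ∂ν := by
      rw [← integral_const_mul]
      refine integral_congr_ae (ae_of_all _ fun x => ?_)
      simp only
      rw [abs_of_nonneg (mul_nonneg two_pos.le (hg0 x)), mul_assoc]
    rw [e1]
    refine hsob.trans ?_
    rw [e2, mul_pow]
    have h3 : 0 ≤ ∫ x, g x ^ 2 ∂ν := integral_nonneg fun x => by positivity
    nlinarith [mul_le_mul_of_nonneg_left hD h3]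
  set E := {x | t < f x} with hE
  have hEm : MeasurableSet E := (isOpen_lt continuous_const hf.continuous).measurableSet
  have hfin : IsFiniteMeasure (ν.restrict E) := ⟨by
    rw [Measure.restrict_apply_univ]; exact (measure_superlevel_ne_top hc δ ht).lt_top⟩
  have hvan : ∀ x ∉ E, g x = 0 := fun x hx => max_eq_right (by simpa [E] using hx)
  -- Cauchy-Schwarz against the indicator of $\{f>t\}$. Combined with `h1` this bounds $A^2$ by a
  -- multiple of $A$, and $A$ can be divided out unless it is zero.
  have h2 : (∫ x, g x ^ 2 ∂ν) ^ 2 ≤ superlevel δ f t * ∫ x, g x ^ 4 ∂ν := by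
    have hg2 : MemLp (fun x => g x ^ 2) 2 ν :=
      (memLp_two_iff_integrable_sq (by fun_prop)).2
        (by simpa only [← pow_mul] using hgi (2 * 2) (by norm_num))
    have hcs := sq_integral_mul_le (μ := ν.restrict E) (a := fun _ => 1)
      (b := fun x => g x ^ 2) (fun _ => zero_le_one) (fun _ => by positivity)
      (memLp_const 1) (hg2.restrict E)
    simp only [one_mul, one_pow, ← pow_mul] at hcs
    rw [setIntegral_const, smul_eq_mul, mul_one,
      setIntegral_eq_integral_of_forall_compl_eq_zero (s := E) (f := fun x => g x ^ 2)
        (fun x hx => by simp [hvan x hx]),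
      setIntegral_eq_integral_of_forall_compl_eq_zero (s := E) (f := fun x => g x ^ (2 * 2))
        (fun x hx => by simp [hvan x hx])] at hcs
    exact hcs
  set A := ∫ x, g x ^ 4 ∂ν with hA
  set B := ∫ x, g x ^ 2 ∂ν with hB
  have hA0 : 0 ≤ A := integral_nonneg fun x => by positivity
  have hB0 : 0 ≤ B := integral_nonneg fun x => by positivity
  have hDn : 0 ≤ D := hD0.trans hD
  have hμ := superlevel_nonneg δ f t
  change A ≤ _
  rcases hA0.eq_or_lt with h | h
  · rw [← h]; positivity
  · have h3 : A ^ 2 ≤ (16 * D ^ 2 * superlevel δ f t) * A :=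
      calc A ^ 2 ≤ (4 * B * D) ^ 2 := pow_le_pow_left₀ hA0 h1 2
        _ = 16 * D ^ 2 * B ^ 2 := by ring
        _ ≤ 16 * D ^ 2 * (superlevel δ f t * A) := by gcongr
        _ = _ := by ring
    rw [sq] at h3
    exact le_of_mul_le_mul_right h3 h

theorem integral_excess_pow_four_le_exp {f : Plane → ℝ} (hf : ContDiff ℝ 1 f)
    (hc : HasCompactSupport f) {δ D M t : ℝ} (ht : 0 < t) {N : ℕ} (hN : 1 ≤ N)
    (hD : ∫ x in shiftedHalf δ, ‖fderiv ℝ f x‖ ^ 2 ≤ D)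
    (hM : ∫ x in shiftedHalf δ, f x ^ 2 ≤ M) (hNt : 32 * D * N ≤ t ^ 2) :
    ∫ x in shiftedHalf δ, max (f x - t) 0 ^ 4 ≤
      16 * D ^ 2 * (4 * M / t ^ 2 * Real.exp (-(N / 2))) :=
  (integral_excess_pow_four_le hf hc ht.le hD).trans <| by
    gcongr
    exact superlevel_le_of_integral_le hf hc ht hN hD hM hNt

end HalfPlane

/-! ### Mollification on the half-plane. -/

theorem sq_lintegral_le_lintegral_sq {α : Type*} {m : MeasurableSpace α} (μ : Measure α)
    [IsProbabilityMeasure μ] {h : α → ENNReal} (hh : AEMeasurable h μ) :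
    (∫⁻ x, h x ∂μ) ^ 2 ≤ ∫⁻ x, h x ^ 2 ∂μ := by
  have key := ENNReal.lintegral_mul_le_Lp_mul_Lq μ Real.HolderConjugate.two_two hh
    (aemeasurable_const (b := (1 : ENNReal)))
  simp only [Pi.mul_apply, mul_one, lintegral_const, measure_univ, ENNReal.rpow_two, one_pow,
    ENNReal.one_rpow] at key
  calc (∫⁻ x, h x ∂μ) ^ 2 ≤ ((∫⁻ x, h x ^ 2 ∂μ) ^ (1 / 2 : ℝ)) ^ 2 := by gcongr
    _ = _ := by rw [← ENNReal.rpow_natCast, ← ENNReal.rpow_mul]; norm_num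

namespace HalfPlane

theorem measurableSet_upperHalf : MeasurableSet upperHalf :=
  (isOpen_lt continuous_const (by fun_prop)).measurableSet

/-- The convolution of `W` with the kernel `κ`. -/
noncomputable def mollify (κ W : Plane → ℝ) (x : Plane) : ℝ := ∫ t, κ (x - t) * W t

theorem mollify_eq_convolution (κ W : Plane → ℝ) :
    mollify κ W = convolution W κ (ContinuousLinearMap.lsmul ℝ ℝ).flip volume := rfl

theorem contDiff_mollify {κ W : Plane → ℝ} (hκ : ContDiff ℝ ∞ κ) (hc : HasCompactSupport κ)
    (hW : LocallyIntegrable W) : ContDiff ℝ 1 (mollify κ W) := by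
  rw [mollify_eq_convolution]
  exact_mod_cast hc.contDiff_convolution_right (n := 1) _ hW (hκ.of_le (by simp))

theorem fderiv_mollify_apply {κ W : Plane → ℝ} (hκ : ContDiff ℝ ∞ κ) (hc : HasCompactSupport κ)
    (hW : LocallyIntegrable W) (x e : Plane) :
    fderiv ℝ (mollify κ W) x e = ∫ t, fderiv ℝ κ (x - t) e * W t := by
  rw [mollify_eq_convolution, (hc.hasFDerivAt_convolution_right _ hW (hκ.of_le (by simp)) x).fderiv,
    convolution_precompR_apply _ hW (hc.fderiv (𝕜 := ℝ)) (hκ.continuous_fderiv (by simp))]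
  rfl

/-- Away from the boundary, mollification commutes with weak derivatives. -/
theorem fderiv_mollify_basisVec {κ w g : Plane → ℝ} {i : Fin 2} (hw : HasWeakPartial i w g)
    (hκ : ContDiff ℝ ∞ κ) (hc : HasCompactSupport κ)
    (hW : LocallyIntegrable (upperHalf.indicator w)) {r : ℝ}
    (hr : Function.support κ ⊆ Metric.closedBall 0 r) {x : Plane} (hx : r < x 1) :
    fderiv ℝ (mollify κ (upperHalf.indicator w)) x (basisVec i) =
      mollify κ (upperHalf.indicator g) x := by
  -- The reflected kernel is an admissible test function: its support lies within $r$ of $x$, and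
  -- $r<x_2$. The sign from the reflection cancels the sign in the weak derivative.
  set φ : Plane → ℝ := fun t => κ (x - t) with hφ
  have hφ1 : ContDiff ℝ ∞ φ := hκ.comp (contDiff_const.sub contDiff_id)
  have hφc : HasCompactSupport φ := hc.comp_homeomorph (Homeomorph.subLeft x)
  have hφs : tsupport φ ⊆ upperHalf := by
    have h1 : tsupport φ ⊆ Metric.closedBall x r := by
      refine closure_minimal (fun t ht => ?_) Metric.isClosed_closedBall
      have h2 : x - t ∈ Metric.closedBall 0 r := hr ht
      rw [Metric.mem_closedBall, dist_comm, dist_eq_norm]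
      simpa using h2
    intro t ht
    have h3 : ‖x - t‖ ≤ r := by
      have := h1 ht
      rwa [Metric.mem_closedBall, dist_comm, dist_eq_norm] at this
    have h4 : |(x - t) 1| ≤ ‖x - t‖ := PiLp.norm_apply_le (x - t) 1
    have h5 : x 1 - t 1 ≤ r := (le_abs_self _).trans (h4.trans h3)
    change 0 < t 1
    linarith
  have hφd : ∀ t, fderiv ℝ φ t (basisVec i) = - fderiv ℝ κ (x - t) (basisVec i) := by
    intro t
    have h1 : HasFDerivAt (fun t : Plane => x - t) (-ContinuousLinearMap.id ℝ Plane) t :=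
      (hasFDerivAt_id t).const_sub x
    have h2 := (hκ.differentiable (by simp) (x - t)).hasFDerivAt.comp t h1
    have h3 : fderiv ℝ φ t = (fderiv ℝ κ (x - t)).comp (-ContinuousLinearMap.id ℝ Plane) :=
      h2.fderiv
    rw [h3]
    simp
  have key := hw.2.2 φ hφ1 hφc hφs
  rw [fderiv_mollify_apply hκ hc hW]
  simp only [vol, hφd] at key
  rw [← integral_indicator measurableSet_upperHalf,
    ← integral_indicator measurableSet_upperHalf] at key
  have e1 : ∀ t, fderiv ℝ κ (x - t) (basisVec i) * upperHalf.indicator w t =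
      - upperHalf.indicator (fun t => w t * - fderiv ℝ κ (x - t) (basisVec i)) t := by
    intro t
    by_cases ht : t ∈ upperHalf
    · simp only [Set.indicator_of_mem ht]; ring
    · simp [Set.indicator_of_notMem ht]
  have e2 : ∀ t, κ (x - t) * upperHalf.indicator g t =
      upperHalf.indicator (fun t => g t * φ t) t := by
    intro t
    by_cases ht : t ∈ upperHalf
    · simp only [Set.indicator_of_mem ht, φ]; ring
    · simp [Set.indicator_of_notMem ht]
  simp only [mollify, e1, e2]
  rw [integral_neg, key, neg_neg]

/-- Convolution with a probability density does not increase the `L²` norm. -/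
theorem lintegral_mollify_sq_le {κ W : Plane → ℝ} (hκ : Continuous κ) (h0 : ∀ x, 0 ≤ κ x)
    (hi : Integrable κ) (h1 : ∫ x, κ x = 1) (hW : AEStronglyMeasurable W) :
    ∫⁻ x, ‖mollify κ W x‖ₑ ^ 2 ≤ ∫⁻ x, ‖W x‖ₑ ^ 2 := by
  have hone : ∫⁻ x, ‖κ x‖ₑ = 1 := by
    rw [← ENNReal.ofReal_one, ← h1, ofReal_integral_eq_lintegral_ofReal hi (ae_of_all _ h0)]
    refine lintegral_congr fun x => ?_
    rw [Real.enorm_of_nonneg (h0 x)]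
  have hone' : ∀ x, ∫⁻ t, ‖κ (x - t)‖ₑ = 1 := fun x => by
    rw [lintegral_sub_left_eq_self (fun t => ‖κ t‖ₑ) x, hone]
  have hpt : ∀ x, ‖mollify κ W x‖ₑ ^ 2 ≤ ∫⁻ t, ‖κ (x - t)‖ₑ * ‖W t‖ₑ ^ 2 := by
    intro x
    have hkm : Measurable fun t => ‖κ (x - t)‖ₑ :=
      (Continuous.enorm (by fun_prop)).measurable
    -- The mollified value is an average of `W` against this probability measure, so Jensen gives
    -- the pointwise bound and Tonelli the integrated one.
    let P : Measure Plane := volume.withDensity fun t => ‖κ (x - t)‖ₑ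
    have hP : IsProbabilityMeasure P := ⟨by
      rw [withDensity_apply _ MeasurableSet.univ, Measure.restrict_univ, hone' x]⟩
    have hWP : AEMeasurable (fun t => ‖W t‖ₑ) P :=
      hW.enorm.mono_ac (withDensity_absolutelyContinuous _ _)
    have h2 := sq_lintegral_le_lintegral_sq P hWP
    rw [lintegral_withDensity_eq_lintegral_mul₀ hkm.aemeasurable hW.enorm,
      lintegral_withDensity_eq_lintegral_mul₀ hkm.aemeasurable (hW.enorm.pow_const 2)] at h2
    refine le_trans ?_ h2
    gcongr
    refine (enorm_integral_le_lintegral_enorm _).trans (le_of_eq (lintegral_congr fun t => ?_))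
    simp [enorm_mul]
  calc ∫⁻ x, ‖mollify κ W x‖ₑ ^ 2 ≤ ∫⁻ x, ∫⁻ t, ‖κ (x - t)‖ₑ * ‖W t‖ₑ ^ 2 :=
        lintegral_mono hpt
    _ = ∫⁻ t, ∫⁻ x, ‖κ (x - t)‖ₑ * ‖W t‖ₑ ^ 2 := by
        refine lintegral_lintegral_swap ?_
        have hk : Measurable fun p : Plane × Plane => ‖κ (p.1 - p.2)‖ₑ :=
          (Continuous.enorm (by fun_prop)).measurable
        exact hk.aemeasurable.mul
          ((hW.enorm.pow_const 2).comp_quasiMeasurePreserving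
            Measure.quasiMeasurePreserving_snd)
    _ = ∫⁻ t, ‖W t‖ₑ ^ 2 := by
        refine lintegral_congr fun t => ?_
        rw [lintegral_mul_const _ (Continuous.enorm (by fun_prop)).measurable,
          lintegral_sub_right_eq_self (fun x => ‖κ x‖ₑ) t, hone, one_mul]

theorem norm_le_abs_add_abs (L : Plane →L[ℝ] ℝ) :
    ‖L‖ ≤ |L (basisVec 0)| + |L (basisVec 1)| := by
  refine L.opNorm_le_bound (by positivity) fun v => ?_
  have hv : v = v 0 • basisVec 0 + v 1 • basisVec 1 := by
    rw [← ofPair_eq]; exact eq_ofPair v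
  have h0 : |v 0| ≤ ‖v‖ := PiLp.norm_apply_le v 0
  have h1 : |v 1| ≤ ‖v‖ := PiLp.norm_apply_le v 1
  calc ‖L v‖ = |v 0 * L (basisVec 0) + v 1 * L (basisVec 1)| := by
        conv_lhs => rw [hv]
        simp
    _ ≤ |v 0| * |L (basisVec 0)| + |v 1| * |L (basisVec 1)| := by
        rw [← abs_mul, ← abs_mul]; exact abs_add_le _ _
    _ ≤ ‖v‖ * |L (basisVec 0)| + ‖v‖ * |L (basisVec 1)| := by gcongr
    _ = _ := by ring

end HalfPlane

/-! ### Approximation by test functions and passage to the limit. -/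

namespace HalfPlane

theorem integral_sq_le_of_lintegral_enorm_le {α : Type*} {m : MeasurableSpace α} {μ : Measure α}
    {f : α → ℝ} (hf : AEStronglyMeasurable f μ) {c : ℝ} (hc : 0 ≤ c)
    (h : ∫⁻ x, ‖f x‖ₑ ^ 2 ∂μ ≤ ENNReal.ofReal c) : ∫ x, f x ^ 2 ∂μ ≤ c := by
  rw [integral_eq_lintegral_of_nonneg_ae (ae_of_all _ fun x => by positivity) (by fun_prop)]
  refine ENNReal.toReal_le_of_le_ofReal hc (le_trans (le_of_eq (lintegral_congr fun x => ?_)) h)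
  rw [← ofReal_norm, ← ENNReal.ofReal_pow (norm_nonneg _), Real.norm_eq_abs, sq_abs]

/-- A smooth bump equal to `1` on the unit ball and supported in the ball of radius `2`. -/
noncomputable def bump : ContDiffBump (0 : Plane) := ⟨1, 2, one_pos, one_lt_two⟩

/-- Cutoff functions exhausting the plane. -/
noncomputable def cutoff (n : ℕ) (x : Plane) : ℝ := bump (((n : ℝ) + 1)⁻¹ • x)

theorem contDiff_cutoff (n : ℕ) : ContDiff ℝ 1 (cutoff n) :=
  bump.contDiff.comp (contDiff_const_smul _)

theorem hasCompactSupport_cutoff (n : ℕ) : HasCompactSupport (cutoff n) :=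
  bump.hasCompactSupport.comp_smul (by positivity)

theorem abs_cutoff_le_one (n : ℕ) (x : Plane) : |cutoff n x| ≤ 1 := by
  rw [cutoff, abs_of_nonneg bump.nonneg]
  exact bump.le_one

theorem tendsto_cutoff (x : Plane) : Tendsto (fun n => cutoff n x) atTop (𝓝 1) := by
  have h1 : Tendsto (fun n : ℕ => ((n : ℝ) + 1)⁻¹ • x) atTop (𝓝 ((0 : ℝ) • x)) := by
    refine Tendsto.smul_const ?_ x
    simpa only [one_div] using tendsto_one_div_add_atTop_nhds_zero_nat (𝕜 := ℝ)
  rw [zero_smul] at h1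
  have h2 := (bump.continuous.tendsto 0).comp h1
  have h3 : bump 0 = 1 := bump.one_of_mem_closedBall (by simp [bump])
  rwa [h3] at h2

theorem exists_norm_fderiv_cutoff_le : ∃ K : ℝ, ∀ n x, ‖fderiv ℝ (cutoff n) x‖ ≤ K := by
  obtain ⟨K, hK⟩ := (bump.hasCompactSupport.fderiv (𝕜 := ℝ)).exists_bound_of_continuous
    ((bump.contDiff (n := 1)).continuous_fderiv (by norm_num))
  have hK0 : 0 ≤ K := (norm_nonneg _).trans (hK 0)
  refine ⟨K, fun n x => ?_⟩
  have h1 : fderiv ℝ (cutoff n) x = ((n : ℝ) + 1)⁻¹ • fderiv ℝ bump (((n : ℝ) + 1)⁻¹ • x) :=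
    fderiv_comp_smul _
  have h2 : ((n : ℝ) + 1)⁻¹ ≤ 1 := inv_le_one_of_one_le₀ (by simp)
  have h3 : (0 : ℝ) ≤ ((n : ℝ) + 1)⁻¹ := by positivity
  rw [h1, norm_smul, Real.norm_of_nonneg h3]
  calc _ ≤ 1 * K := mul_le_mul h2 (hK _) (norm_nonneg _) zero_le_one
    _ = K := one_mul K

/-- Local approximation of a Sobolev function on the half-plane by test functions of the plane. -/
theorem exists_approximation {K : ℝ} (hK : ∀ n x, ‖fderiv ℝ (cutoff n) x‖ ≤ K)
    {w : Plane → ℝ} {g : Fin 2 → Plane → ℝ} (hw : ∀ i, HasWeakPartial i w (g i))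
    (hw2 : MemLp w 2 vol) (hg2 : ∀ i, MemLp (g i) 2 vol) {h δ : ℝ} (hδ : 0 < δ)
    (hH : ∫⁻ x, ‖w x‖ₑ ^ 2 ∂vol + (∫⁻ x, ‖g 0 x‖ₑ ^ 2 ∂vol + ∫⁻ x, ‖g 1 x‖ₑ ^ 2 ∂vol) ≤
      ENNReal.ofReal (h ^ 2)) :
    ∃ f : ℕ → Plane → ℝ, (∀ n, ContDiff ℝ 1 (f n)) ∧ (∀ n, HasCompactSupport (f n)) ∧
      (∀ n, ∫ x in shiftedHalf δ, f n x ^ 2 ≤ h ^ 2) ∧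
      (∀ n, ∫ x in shiftedHalf δ, ‖fderiv ℝ (f n) x‖ ^ 2 ≤ (4 + 2 * K ^ 2) * h ^ 2) ∧
      ∀ᵐ x ∂(volume.restrict (shiftedHalf δ)), Tendsto (fun n => f n x) atTop (𝓝 (w x)) := by
  set W := upperHalf.indicator w with hWdef
  set G : Fin 2 → Plane → ℝ := fun i => upperHalf.indicator (g i) with hGdef
  have hWm : MemLp W 2 volume := (memLp_indicator_iff_restrict measurableSet_upperHalf).2 hw2
  have hGm : ∀ i, MemLp (G i) 2 volume := fun i =>
    (memLp_indicator_iff_restrict measurableSet_upperHalf).2 (hg2 i)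
  have hWl : LocallyIntegrable W := hWm.locallyIntegrable (by norm_num)
  have hGl : ∀ i, LocallyIntegrable (G i) := fun i => (hGm i).locallyIntegrable (by norm_num)
  have hind : ∀ v : Plane → ℝ, ∫⁻ x, ‖upperHalf.indicator v x‖ₑ ^ 2 = ∫⁻ x, ‖v x‖ₑ ^ 2 ∂vol := by
    intro v
    rw [vol, ← lintegral_indicator measurableSet_upperHalf]
    refine lintegral_congr fun x => ?_
    by_cases hx : x ∈ upperHalf
    · simp [Set.indicator_of_mem hx]
    · simp [Set.indicator_of_notMem hx]
  -- The shift by $2$ keeps the outer radius below $\delta$ already at $n=0$, so mollified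
  -- derivatives are correct on $\{x_2>\delta\}$. The fixed ratio of radii is needed for almost
  -- everywhere convergence.
  let b : ℕ → ContDiffBump (0 : Plane) := fun n =>
    ⟨δ / (2 * ((n : ℝ) + 2)), δ / ((n : ℝ) + 2), by positivity, by
      rw [div_lt_div_iff_of_pos_left hδ (by positivity) (by positivity)]
      linarith [(Nat.cast_nonneg n : (0 : ℝ) ≤ n)]⟩
  have hbr : ∀ n, (b n).rOut < δ := fun n => by
    change δ / ((n : ℝ) + 2) < δ
    rw [div_lt_iff₀ (by positivity)]
    nlinarith [(Nat.cast_nonneg n : (0 : ℝ) ≤ n)]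
  let κ : ℕ → Plane → ℝ := fun n => (b n).normed volume
  have hκ : ∀ n, ContDiff ℝ ∞ (κ n) := fun n => (b n).contDiff_normed
  have hκc : ∀ n, HasCompactSupport (κ n) := fun n => (b n).hasCompactSupport_normed
  have hκs : ∀ n, Function.support (κ n) ⊆ Metric.closedBall 0 (b n).rOut := fun n => by
    rw [show Function.support (κ n) = _ from (b n).support_normed_eq]
    exact Metric.ball_subset_closedBall
  have hmol : ∀ n (V : Plane → ℝ), AEStronglyMeasurable V →
      ∫⁻ x, ‖mollify (κ n) V x‖ₑ ^ 2 ≤ ∫⁻ x, ‖V x‖ₑ ^ 2 := fun n V hV =>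
    lintegral_mollify_sq_le (hκ n).continuous (b n).nonneg_normed (b n).integrable_normed
      (b n).integral_normed hV
  let v : ℕ → Plane → ℝ := fun n => mollify (κ n) W
  have hv : ∀ n, ContDiff ℝ 1 (v n) := fun n => contDiff_mollify (hκ n) (hκc n) hWl
  have hGc : ∀ n i, Continuous (mollify (κ n) (G i)) := fun n i =>
    (contDiff_mollify (hκ n) (hκc n) (hGl i)).continuous
  have hf : ∀ n, ContDiff ℝ 1 fun x => cutoff n x * v n x := fun n => (contDiff_cutoff n).mul (hv n)
  refine ⟨fun n x => cutoff n x * v n x, hf, fun n => (hasCompactSupport_cutoff n).mul_right,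
    fun n => ?_, fun n => ?_, ?_⟩
  · refine integral_sq_le_of_lintegral_enorm_le (hf n).continuous.aestronglyMeasurable
      (by positivity) ?_
    calc ∫⁻ x in shiftedHalf δ, ‖cutoff n x * v n x‖ₑ ^ 2 ≤ ∫⁻ x, ‖cutoff n x * v n x‖ₑ ^ 2 :=
          setLIntegral_le_lintegral _ _
      _ ≤ ∫⁻ x, ‖v n x‖ₑ ^ 2 := by
          refine lintegral_mono fun x => pow_le_pow_left₀ zero_le (enorm_le_iff_norm_le.2 ?_) 2
          rw [norm_mul]
          exact mul_le_of_le_one_left (norm_nonneg _) (abs_cutoff_le_one n x)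
      _ ≤ ∫⁻ x, ‖W x‖ₑ ^ 2 := hmol n W hWm.1
      _ = ∫⁻ x, ‖w x‖ₑ ^ 2 ∂vol := hind w
      _ ≤ _ := le_self_add.trans hH
  · refine integral_sq_le_of_lintegral_enorm_le
      (continuous_norm_fderiv (hf n)).aestronglyMeasurable (by positivity) ?_
    set C := ENNReal.ofReal (4 + 2 * K ^ 2) with hC
    have hpt : ∀ x ∈ shiftedHalf δ, ‖‖fderiv ℝ (fun x => cutoff n x * v n x) x‖‖ₑ ^ 2 ≤
        C * (‖v n x‖ₑ ^ 2 + (‖mollify (κ n) (G 0) x‖ₑ ^ 2 + ‖mollify (κ n) (G 1) x‖ₑ ^ 2)) := by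
      intro x hx
      have hd : ∀ i, fderiv ℝ (v n) x (basisVec i) = mollify (κ n) (G i) x := fun i =>
        fderiv_mollify_basisVec (hw i) (hκ n) (hκc n) hWl (hκs n) ((hbr n).trans hx)
      have hprod : fderiv ℝ (fun x => cutoff n x * v n x) x =
          cutoff n x • fderiv ℝ (v n) x + v n x • fderiv ℝ (cutoff n) x :=
        fderiv_mul ((contDiff_cutoff n).differentiable (by norm_num) x)
          ((hv n).differentiable (by norm_num) x)
      have hn : ‖fderiv ℝ (fun x => cutoff n x * v n x) x‖ ≤
          |mollify (κ n) (G 0) x| + |mollify (κ n) (G 1) x| + |v n x| * K := by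
        rw [hprod]
        refine (norm_add_le _ _).trans (add_le_add ?_ ?_)
        · rw [norm_smul, ← hd, ← hd]
          exact (mul_le_of_le_one_left (norm_nonneg _) (abs_cutoff_le_one n x)).trans
            (norm_le_abs_add_abs _)
        · rw [norm_smul]
          exact mul_le_mul_of_nonneg_left (hK n x) (norm_nonneg _)
      have hsq : ‖fderiv ℝ (fun x => cutoff n x * v n x) x‖ ^ 2 ≤ (4 + 2 * K ^ 2) *
          (v n x ^ 2 + (mollify (κ n) (G 0) x ^ 2 + mollify (κ n) (G 1) x ^ 2)) := by
        refine (pow_le_pow_left₀ (norm_nonneg _) hn 2).trans ?_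
        rw [← sq_abs (v n x), ← sq_abs (mollify (κ n) (G 0) x), ← sq_abs (mollify (κ n) (G 1) x)]
        set p := |mollify (κ n) (G 0) x|
        set q := |mollify (κ n) (G 1) x|
        set r := |v n x|
        -- The coefficients $4$ (derivatives) and $2K^2$ (cutoff gradient) are both covered by
        -- $4+2K^2$.
        have h1 : (p + q + r * K) ^ 2 ≤ 4 * p ^ 2 + 4 * q ^ 2 + 2 * (r * K) ^ 2 := by
          nlinarith [sq_nonneg (p - q), sq_nonneg (p + q - r * K)]
        have h2 : 0 ≤ K ^ 2 * p ^ 2 := by positivity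
        have h3 : 0 ≤ K ^ 2 * q ^ 2 := by positivity
        nlinarith [sq_nonneg r]
      have hen : ∀ s : ℝ, ‖s‖ₑ ^ 2 = ENNReal.ofReal (s ^ 2) := fun s => by
        rw [← ofReal_norm, ← ENNReal.ofReal_pow (norm_nonneg _), Real.norm_eq_abs, sq_abs]
      simp only [hen, hC]
      rw [← ENNReal.ofReal_add (by positivity) (by positivity),
        ← ENNReal.ofReal_add (by positivity) (by positivity),
        ← ENNReal.ofReal_mul (by positivity)]
      exact ENNReal.ofReal_le_ofReal hsq
    have hvm : Measurable fun x => ‖v n x‖ₑ ^ 2 := ((hv n).continuous.enorm.measurable).pow_const 2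
    have hGm' : ∀ i, Measurable fun x => ‖mollify (κ n) (G i) x‖ₑ ^ 2 := fun i =>
      ((hGc n i).enorm.measurable).pow_const 2
    calc ∫⁻ x in shiftedHalf δ, ‖‖fderiv ℝ (fun x => cutoff n x * v n x) x‖‖ₑ ^ 2
        ≤ ∫⁻ x in shiftedHalf δ, C * (‖v n x‖ₑ ^ 2 +
          (‖mollify (κ n) (G 0) x‖ₑ ^ 2 + ‖mollify (κ n) (G 1) x‖ₑ ^ 2)) :=
          setLIntegral_mono' (measurableSet_shiftedHalf δ) hpt
      _ ≤ ∫⁻ x, C * (‖v n x‖ₑ ^ 2 +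
          (‖mollify (κ n) (G 0) x‖ₑ ^ 2 + ‖mollify (κ n) (G 1) x‖ₑ ^ 2)) :=
          setLIntegral_le_lintegral _ _
      _ = C * ((∫⁻ x, ‖v n x‖ₑ ^ 2) +
          ((∫⁻ x, ‖mollify (κ n) (G 0) x‖ₑ ^ 2) + ∫⁻ x, ‖mollify (κ n) (G 1) x‖ₑ ^ 2)) := by
          rw [← lintegral_add_left (hGm' 0), ← lintegral_add_left hvm]
          exact lintegral_const_mul C (hvm.add ((hGm' 0).add (hGm' 1)))
      _ ≤ C * (∫⁻ x, ‖w x‖ₑ ^ 2 ∂vol +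
          (∫⁻ x, ‖g 0 x‖ₑ ^ 2 ∂vol + ∫⁻ x, ‖g 1 x‖ₑ ^ 2 ∂vol)) := by
          rw [← hind w, ← hind (g 0), ← hind (g 1)]
          exact mul_le_mul_right (add_le_add (hmol n W hWm.1)
            (add_le_add (hmol n (G 0) (hGm 0).1) (hmol n (G 1) (hGm 1).1))) C
      _ ≤ C * ENNReal.ofReal (h ^ 2) := mul_le_mul_right hH C
      _ = _ := by rw [hC, ← ENNReal.ofReal_mul (by positivity)]
  · have hlim : ∀ᵐ x ∂(volume : Measure Plane), Tendsto (fun n => v n x) atTop (𝓝 (W x)) := by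
      have hr : Tendsto (fun n => (b n).rOut) atTop (𝓝 0) := by
        change Tendsto (fun n : ℕ => δ / ((n : ℝ) + 2)) atTop (𝓝 0)
        exact tendsto_const_nhds.div_atTop
          (tendsto_atTop_add_const_right _ _ tendsto_natCast_atTop_atTop)
      have hr2 : ∀ᶠ n in atTop, (b n).rOut ≤ 2 * (b n).rIn := by
        refine Eventually.of_forall fun n => le_of_eq ?_
        change δ / ((n : ℝ) + 2) = 2 * (δ / (2 * ((n : ℝ) + 2)))
        field_simp
      have := ContDiffBump.ae_convolution_tendsto_right_of_locallyIntegrable hr hr2 hWl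
      filter_upwards [this] with x hx
      refine hx.congr fun n => ?_
      exact convolution_lsmul_swap
    filter_upwards [ae_restrict_of_ae hlim, ae_restrict_mem (measurableSet_shiftedHalf δ)]
      with x hx hxδ
    have hxu : x ∈ upperHalf := hδ.trans hxδ
    rw [hWdef, Set.indicator_of_mem hxu] at hx
    simpa using (tendsto_cutoff x).mul hx

theorem upperHalf_eq_iUnion : upperHalf = ⋃ n : ℕ, shiftedHalf (1 / ((n : ℝ) + 1)) := by
  ext x
  simp only [Set.mem_iUnion]
  constructor
  · intro hx
    exact exists_nat_one_div_lt (show 0 < x 1 from hx)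
  · rintro ⟨n, hn⟩
    exact (by positivity : (0 : ℝ) < 1 / ((n : ℝ) + 1)).trans hn

/-- Exponential smallness of the excess of an `H¹` function over a high level. -/
theorem lintegral_excess_pow_four_le {K : ℝ} (hK : ∀ n x, ‖fderiv ℝ (cutoff n) x‖ ≤ K)
    {w : Plane → ℝ} {g : Fin 2 → Plane → ℝ} (hw : ∀ i, HasWeakPartial i w (g i))
    (hw2 : MemLp w 2 vol) (hg2 : ∀ i, MemLp (g i) 2 vol) {h t : ℝ} (ht : 0 < t)
    (hH : ∫⁻ x, ‖w x‖ₑ ^ 2 ∂vol + (∫⁻ x, ‖g 0 x‖ₑ ^ 2 ∂vol + ∫⁻ x, ‖g 1 x‖ₑ ^ 2 ∂vol) ≤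
      ENNReal.ofReal (h ^ 2)) {N : ℕ} (hN : 1 ≤ N)
    (hNt : 32 * ((4 + 2 * K ^ 2) * h ^ 2) * N ≤ t ^ 2) :
    ∫⁻ x, ENNReal.ofReal (max (|w x| - t) 0 ^ 4) ∂vol ≤
      ENNReal.ofReal (2 * (16 * ((4 + 2 * K ^ 2) * h ^ 2) ^ 2 *
        (4 * h ^ 2 / t ^ 2 * Real.exp (-(N / 2))))) := by
  set D := (4 + 2 * K ^ 2) * h ^ 2 with hDdef
  set B := 16 * D ^ 2 * (4 * h ^ 2 / t ^ 2 * Real.exp (-(N / 2))) with hB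
  have hloc : ∀ δ : ℝ, 0 < δ →
      ∫⁻ x in shiftedHalf δ, ENNReal.ofReal (max (|w x| - t) 0 ^ 4) ≤ ENNReal.ofReal (2 * B) := by
    intro δ hδ
    obtain ⟨f, hf1, hfc, hfM, hfD, hlim⟩ := exists_approximation hK hw hw2 hg2 hδ hH
    have hbd : ∀ n, ∫⁻ x in shiftedHalf δ, ENNReal.ofReal (max (|f n x| - t) 0 ^ 4) ≤
        ENNReal.ofReal (2 * B) := by
      intro n
      -- The excess of $|f|$ is treated as that of $f$ plus that of $-f$, whence the factor $2$ in
      -- the bound.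
      have hp := integral_excess_pow_four_le_exp (hf1 n) (hfc n) ht hN (hfD n) (hfM n) hNt
      have hm := integral_excess_pow_four_le_exp (f := fun x => - f n x) (hf1 n).neg (hfc n).neg
        ht hN (δ := δ) (D := D) (M := h ^ 2)
        (by simpa only [fderiv_fun_neg, norm_neg] using hfD n) (by simpa using hfM n) hNt
      have hcont := (hf1 n).continuous
      have h00 : max (0 - t) 0 = 0 := max_eq_right (by linarith)
      have hip : Integrable (fun x => max (f n x - t) 0 ^ 4) (volume.restrict (shiftedHalf δ)) :=
        Continuous.integrable_pow_of_hasCompactSupport (g := fun x => max (f n x - t) 0)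
          (by fun_prop) ((hfc n).comp_left (g := fun s => max (s - t) 0) h00) (by norm_num) _
      have him : Integrable (fun x => max (- f n x - t) 0 ^ 4)
          (volume.restrict (shiftedHalf δ)) :=
        Continuous.integrable_pow_of_hasCompactSupport (g := fun x => max (- f n x - t) 0)
          (by fun_prop) ((hfc n).comp_left (g := fun s => max (-s - t) 0)
            (by simp only [neg_zero]; exact h00)) (by norm_num) _
      calc ∫⁻ x in shiftedHalf δ, ENNReal.ofReal (max (|f n x| - t) 0 ^ 4)
          ≤ ∫⁻ x in shiftedHalf δ,
            ENNReal.ofReal (max (f n x - t) 0 ^ 4 + max (- f n x - t) 0 ^ 4) := by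
            refine lintegral_mono fun x => ENNReal.ofReal_le_ofReal ?_
            have h1 : 0 ≤ max (f n x - t) 0 ^ 4 := by positivity
            have h2 : 0 ≤ max (- f n x - t) 0 ^ 4 := by positivity
            rcases abs_cases (f n x) with ⟨h, _⟩ | ⟨h, _⟩ <;> rw [h] <;> linarith
        _ = ENNReal.ofReal (∫ x in shiftedHalf δ,
            (max (f n x - t) 0 ^ 4 + max (- f n x - t) 0 ^ 4)) :=
            (ofReal_integral_eq_lintegral_ofReal (hip.add him)
              (ae_of_all _ fun x => add_nonneg (pow_nonneg (le_max_right _ _) 4)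
                (pow_nonneg (le_max_right _ _) 4))).symm
        _ ≤ _ := by
            refine ENNReal.ofReal_le_ofReal ?_
            rw [integral_add hip him]
            linarith
    calc ∫⁻ x in shiftedHalf δ, ENNReal.ofReal (max (|w x| - t) 0 ^ 4)
        = ∫⁻ x in shiftedHalf δ,
          liminf (fun n => ENNReal.ofReal (max (|f n x| - t) 0 ^ 4)) atTop := by
          refine lintegral_congr_ae ?_
          filter_upwards [hlim] with x hx
          refine (Tendsto.liminf_eq ?_).symm
          have hc : Continuous fun s : ℝ => ENNReal.ofReal (max (|s| - t) 0 ^ 4) :=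
            ENNReal.continuous_ofReal.comp (by fun_prop)
          exact (hc.tendsto (w x)).comp hx
      -- Fatou's lemma: almost everywhere convergence and a uniform bound suffice.
      _ ≤ liminf (fun n => ∫⁻ x in shiftedHalf δ,
          ENNReal.ofReal (max (|f n x| - t) 0 ^ 4)) atTop := by
          refine lintegral_liminf_le fun n => ?_
          have := (hf1 n).continuous
          exact (ENNReal.continuous_ofReal.comp (by fun_prop)).measurable
      _ ≤ liminf (fun _ : ℕ => ENNReal.ofReal (2 * B)) atTop :=
          liminf_le_liminf (Eventually.of_forall hbd)
      _ = _ := liminf_const _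
  -- The bound does not depend on $\delta$, so monotone exhaustion reaches the whole half-plane.
  rw [vol, upperHalf_eq_iUnion, setLIntegral_iUnion_of_directed]
  · exact iSup_le fun n => hloc _ (by positivity)
  · refine Monotone.directed_le fun m n hmn x hx => ?_
    have h1 : 1 / ((n : ℝ) + 1) ≤ 1 / ((m : ℝ) + 1) :=
      one_div_le_one_div_of_le (by positivity) (by simpa using hmn)
    exact h1.trans_lt hx

end HalfPlane

/-! ### Choice of the level and assembly of the estimate. -/

namespace HalfPlane

/-- Almost everywhere uniqueness transfers square integrability from a given weak derivative to the
chosen one. -/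
theorem weakPartial_spec {i : Fin 2} {f g : Plane → ℝ} (hg : HasWeakPartial i f g)
    (hg2 : MemLp g 2 vol) :
    HasWeakPartial i f (weakPartial i f) ∧ MemLp (weakPartial i f) 2 vol := by
  have hex : ∃ g, HasWeakPartial i f g := ⟨g, hg⟩
  have h1 : HasWeakPartial i f (weakPartial i f) := by
    rw [weakPartial, dif_pos hex]
    exact hex.choose_spec
  exact ⟨h1, (memLp_congr_ae (h1.ae_eq hg)).2 hg2⟩

theorem eLpNorm_pow_eq_lintegral {E : Type*} [NormedAddCommGroup E] (f : Plane → E) {p : ℕ}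
    (hp : p ≠ 0) : eLpNorm f p vol ^ p = ∫⁻ x, ‖f x‖ₑ ^ p ∂vol := by
  have h := eLpNorm_nnreal_pow_eq_lintegral (f := f) (μ := vol) (p := (p : NNReal))
    (by simpa using hp)
  simpa only [NNReal.coe_natCast, ENNReal.rpow_natCast, ENNReal.coe_natCast] using h

theorem lintegral_enorm_pow_eq {E : Type*} [NormedAddCommGroup E] {f : Plane → E} {p : ℕ}
    (hp : p ≠ 0) (hf : MemLp f p vol) :
    ∫⁻ x, ‖f x‖ₑ ^ p ∂vol = ENNReal.ofReal (normLp p f ^ p) := by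
  rw [← eLpNorm_pow_eq_lintegral f hp, normLp, ENNReal.ofReal_pow ENNReal.toReal_nonneg,
    ENNReal.ofReal_toReal hf.2.ne]

/-- Either $|a|\le 2t$, and the first term suffices, or $|a|\le 2(|a|-t)$, and the second does. -/
theorem abs_pow_four_le (a t : ℝ) :
    a ^ 4 ≤ 4 * t ^ 2 * a ^ 2 + 16 * max (|a| - t) 0 ^ 4 := by
  rcases le_or_gt |a| (2 * t) with h | h
  · have h1 : a ^ 2 ≤ 4 * t ^ 2 := by
      rw [← sq_abs]
      nlinarith [abs_nonneg a]
    have h2 : 0 ≤ max (|a| - t) 0 ^ 4 := by positivity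
    nlinarith [mul_le_mul_of_nonneg_right h1 (sq_nonneg a)]
  · have h1 : |a| ≤ 2 * max (|a| - t) 0 := by
      have := le_max_left (|a| - t) 0
      linarith
    have h2 := pow_le_pow_left₀ (abs_nonneg a) h1 4
    have h3 : |a| ^ 4 = a ^ 4 := by
      rw [show |a| ^ 4 = (|a| ^ 2) ^ 2 by ring, sq_abs]; ring
    rw [h3, mul_pow] at h2
    have h4 : 0 ≤ 4 * t ^ 2 * a ^ 2 := by positivity
    linarith

theorem norm_sqrt_smul_pow_four_le {r R : ℝ} (hr : 0 ≤ r) (hR : r ≤ R) (y : Plane) (t : ℝ) :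
    ‖√r • y‖ ^ 4 ≤ 8 * t ^ 2 * R * ‖√r • y‖ ^ 2 +
      32 * R ^ 2 * (max (|y 0| - t) 0 ^ 4 + max (|y 1| - t) 0 ^ 4) := by
  have hy : ‖y‖ ^ 2 = y 0 ^ 2 + y 1 ^ 2 := by
    rw [EuclideanSpace.norm_sq_eq]
    simp
  have h2 : ‖√r • y‖ ^ 2 = r * (y 0 ^ 2 + y 1 ^ 2) := by
    rw [norm_smul, mul_pow, hy, Real.norm_eq_abs, sq_abs, Real.sq_sqrt hr]
  have ha := abs_pow_four_le (y 0) t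
  have hb := abs_pow_four_le (y 1) t
  set e := max (|y 0| - t) 0 ^ 4 + max (|y 1| - t) 0 ^ 4 with he
  have he0 : 0 ≤ e := by positivity
  have hs : (y 0 ^ 2 + y 1 ^ 2) ^ 2 ≤ 8 * t ^ 2 * (y 0 ^ 2 + y 1 ^ 2) + 32 * e := by
    nlinarith [sq_nonneg (y 0 ^ 2 - y 1 ^ 2)]
  have hR0 : 0 ≤ R := hr.trans hR
  rw [show ‖√r • y‖ ^ 4 = (‖√r • y‖ ^ 2) ^ 2 by ring, h2]
  set q := y 0 ^ 2 + y 1 ^ 2 with hq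
  have hq0 : 0 ≤ q := by positivity
  calc (r * q) ^ 2 = r ^ 2 * q ^ 2 := by ring
    _ ≤ r ^ 2 * (8 * t ^ 2 * q + 32 * e) := by gcongr
    _ = 8 * t ^ 2 * q * (r * r) + 32 * e * r ^ 2 := by ring
    _ ≤ 8 * t ^ 2 * q * (R * r) + 32 * e * R ^ 2 := by gcongr
    _ = _ := by ring

/-- With $L=\ln(2+h^2)$, the choice $N=\lceil 2L\rceil$ gives $e^{-N/2}\le(2+h^2)^{-1}$, and $N\le
4L$ explains $128=32\cdot4$ in $t^2$. -/
theorem exists_level {c h : ℝ} (hc : 0 < c) (hh : 0 < h) :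
    ∃ t : ℝ, ∃ N : ℕ, 0 < t ∧ 1 ≤ N ∧ t ^ 2 = 128 * c * h ^ 2 * Real.log (2 + h ^ 2) ∧
      32 * (c * h ^ 2) * N ≤ t ^ 2 ∧
      2 * (16 * (c * h ^ 2) ^ 2 * (4 * h ^ 2 / t ^ 2 * Real.exp (-(N / 2)))) ≤
        4 * c * h ^ 2 * Real.log (2 + h ^ 2) := by
  set L := Real.log (2 + h ^ 2) with hL
  -- Used twice: for $2L+1\le 4L$ and for $1/L\le 4L$.
  have hL2 : 1 / 2 < L := by
    have h1 : Real.log 2 ≤ L := Real.log_le_log two_pos (by nlinarith)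
    linarith [Real.log_two_gt_d9]
  have hL0 : 0 < L := by linarith
  have ht2 : √(128 * c * h ^ 2 * L) ^ 2 = 128 * c * h ^ 2 * L := Real.sq_sqrt (by positivity)
  refine ⟨√(128 * c * h ^ 2 * L), ⌈2 * L⌉₊, Real.sqrt_pos.2 (by positivity),
    Nat.one_le_ceil_iff.2 (by positivity), ht2, ?_, ?_⟩
  · rw [ht2]
    have h1 : (⌈2 * L⌉₊ : ℝ) ≤ 4 * L := by
      have := Nat.ceil_lt_add_one (show 0 ≤ 2 * L by positivity)
      linarith
    calc 32 * (c * h ^ 2) * (⌈2 * L⌉₊ : ℝ) ≤ 32 * (c * h ^ 2) * (4 * L) := by gcongr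
      _ = _ := by ring
  · rw [ht2]
    have h1 : Real.exp (-((⌈2 * L⌉₊ : ℝ) / 2)) ≤ (2 + h ^ 2)⁻¹ := by
      rw [← Real.exp_log (show 0 < 2 + h ^ 2 by positivity), ← Real.exp_neg]
      refine Real.exp_le_exp.2 ?_
      linarith [Nat.le_ceil (2 * L)]
    calc 2 * (16 * (c * h ^ 2) ^ 2 *
          (4 * h ^ 2 / (128 * c * h ^ 2 * L) * Real.exp (-((⌈2 * L⌉₊ : ℝ) / 2))))
        ≤ 2 * (16 * (c * h ^ 2) ^ 2 * (4 * h ^ 2 / (128 * c * h ^ 2 * L) * (2 + h ^ 2)⁻¹)) := by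
          gcongr
      _ = c * h ^ 2 * (h ^ 2 / (2 + h ^ 2) * (1 / L)) := by field_simp; ring
      _ ≤ c * h ^ 2 * (1 * (4 * L)) := by
          have h2 : h ^ 2 / (2 + h ^ 2) ≤ 1 := (div_le_one (by positivity)).2 (by linarith)
          have h3 : 1 / L ≤ 4 * L := by
            rw [div_le_iff₀ hL0]
            nlinarith
          gcongr
      _ = _ := by ring

theorem lintegral_pow_four_le {c R h : ℝ} (hc : 0 < c) (hR : 1 ≤ R) (hh : 0 < h)
    {ρ : Plane → ℝ} {u : Plane → Plane} (hρ : ∀ᵐ x ∂vol, 0 ≤ ρ x ∧ ρ x ≤ R)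
    (hv : MemLp (fun x => √(ρ x) • u x) 2 vol) (hu : AEStronglyMeasurable u vol)
    (hex : ∀ (j : Fin 2) (t : ℝ) (N : ℕ), 0 < t → 1 ≤ N → 32 * (c * h ^ 2) * N ≤ t ^ 2 →
      ∫⁻ x, ENNReal.ofReal (max (|u x j| - t) 0 ^ 4) ∂vol ≤
        ENNReal.ofReal (2 * (16 * (c * h ^ 2) ^ 2 *
          (4 * h ^ 2 / t ^ 2 * Real.exp (-(N / 2)))))) :
    ∫⁻ x, ‖√(ρ x) • u x‖ₑ ^ 4 ∂vol ≤ ENNReal.ofReal (1024 * c * R ^ 2 *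
      ((1 + normLp 2 (fun x => √(ρ x) • u x)) ^ 2 * h ^ 2 * Real.log (2 + h ^ 2))) := by
  obtain ⟨t, N, ht, hN, ht2, hNt, hB⟩ := exists_level hc hh
  have hR0 : 0 ≤ R := by linarith
  have hL0 : 0 < Real.log (2 + h ^ 2) := Real.log_pos (by nlinarith)
  set L := Real.log (2 + h ^ 2)
  set V := normLp 2 (fun x => √(ρ x) • u x) with hV
  have hV0 : 0 ≤ V := ENNReal.toReal_nonneg
  have h2 := lintegral_enorm_pow_eq two_ne_zero (by exact_mod_cast hv)
  have hex' : ∀ j : Fin 2, ∫⁻ x, ENNReal.ofReal (max (|u x j| - t) 0 ^ 4) ∂vol ≤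
      ENNReal.ofReal (4 * c * h ^ 2 * L) := fun j =>
    (hex j t N ht hN hNt).trans (ENNReal.ofReal_le_ofReal hB)
  have hum : ∀ j : Fin 2, AEMeasurable (fun x => ENNReal.ofReal (max (|u x j| - t) 0 ^ 4)) vol := by
    intro j
    have hc : Continuous fun y : Plane => ENNReal.ofReal (max (|y j| - t) 0 ^ 4) :=
      ENNReal.continuous_ofReal.comp (by fun_prop)
    exact hc.measurable.comp_aemeasurable hu.aemeasurable
  have hen : ∀ (y : Plane) (n : ℕ), ‖y‖ₑ ^ n = ENNReal.ofReal (‖y‖ ^ n) := fun y n => by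
    rw [← ofReal_norm, ← ENNReal.ofReal_pow (norm_nonneg _)]
  calc ∫⁻ x, ‖√(ρ x) • u x‖ₑ ^ 4 ∂vol
      ≤ ∫⁻ x, (ENNReal.ofReal (8 * t ^ 2 * R) * ‖√(ρ x) • u x‖ₑ ^ 2 +
        ENNReal.ofReal (32 * R ^ 2) * (ENNReal.ofReal (max (|u x 0| - t) 0 ^ 4) +
          ENNReal.ofReal (max (|u x 1| - t) 0 ^ 4))) ∂vol := by
        refine lintegral_mono_ae ?_
        filter_upwards [hρ] with x hx
        rw [hen, hen, ← ENNReal.ofReal_add (by positivity) (by positivity),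
          ← ENNReal.ofReal_mul (by positivity), ← ENNReal.ofReal_mul (by positivity),
          ← ENNReal.ofReal_add (by positivity) (by positivity)]
        exact ENNReal.ofReal_le_ofReal (norm_sqrt_smul_pow_four_le hx.1 hx.2 (u x) t)
    _ = ENNReal.ofReal (8 * t ^ 2 * R) * ∫⁻ x, ‖√(ρ x) • u x‖ₑ ^ 2 ∂vol +
        ENNReal.ofReal (32 * R ^ 2) * (∫⁻ x, ENNReal.ofReal (max (|u x 0| - t) 0 ^ 4) ∂vol +
          ∫⁻ x, ENNReal.ofReal (max (|u x 1| - t) 0 ^ 4) ∂vol) := by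
        rw [← lintegral_add_left' (hum 0), ← lintegral_const_mul' _ _ ENNReal.ofReal_ne_top,
          ← lintegral_const_mul' _ _ ENNReal.ofReal_ne_top]
        exact lintegral_add_right' _ (((hum 0).add (hum 1)).const_mul _)
    _ ≤ ENNReal.ofReal (8 * t ^ 2 * R) * ENNReal.ofReal (V ^ 2) +
        ENNReal.ofReal (32 * R ^ 2) * (ENNReal.ofReal (4 * c * h ^ 2 * L) +
          ENNReal.ofReal (4 * c * h ^ 2 * L)) := by
        rw [h2]
        exact add_le_add le_rfl (mul_le_mul_right (add_le_add (hex' 0) (hex' 1)) _)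
    _ = ENNReal.ofReal (8 * t ^ 2 * R * V ^ 2 +
        32 * R ^ 2 * (4 * c * h ^ 2 * L + 4 * c * h ^ 2 * L)) := by
        rw [← ENNReal.ofReal_add (by positivity) (by positivity),
          ← ENNReal.ofReal_mul (by positivity), ← ENNReal.ofReal_mul (by positivity),
          ← ENNReal.ofReal_add (by positivity) (by positivity)]
    _ ≤ _ := by
        refine ENNReal.ofReal_le_ofReal ?_
        rw [ht2]
        have h3 : R * V ^ 2 ≤ R ^ 2 * V ^ 2 := by
          gcongr
          nlinarith
        have h4 : R * V ^ 2 + R ^ 2 ≤ R ^ 2 * (1 + V) ^ 2 := by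
          nlinarith [mul_nonneg (sq_nonneg R) hV0]
        have h5 : 0 ≤ c * h ^ 2 * L := by positivity
        calc _ = 1024 * (c * h ^ 2 * L) * (R * V ^ 2) + 256 * (c * h ^ 2 * L) * R ^ 2 := by ring
          _ ≤ 1024 * (c * h ^ 2 * L) * (R * V ^ 2) + 1024 * (c * h ^ 2 * L) * R ^ 2 := by
            gcongr
            norm_num
          _ = 1024 * (c * h ^ 2 * L) * (R * V ^ 2 + R ^ 2) := by ring
          _ ≤ 1024 * (c * h ^ 2 * L) * (R ^ 2 * (1 + V) ^ 2) := by gcongr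
          _ = _ := by ring

theorem normH1_sq (u : Plane → Plane) :
    normH1 u ^ 2 = normLp 2 u ^ 2 + ∑ i : Fin 2, ∑ j : Fin 2,
      normLp 2 (weakPartial i (fun x => u x j)) ^ 2 :=
  Real.sq_sqrt (by positivity)

theorem lintegral_component_le {u : Plane → Plane} (hu : MemH1 u) (j : Fin 2) {h : ℝ}
    (hh : normH1 u ≤ h) :
    ∫⁻ x, ‖u x j‖ₑ ^ 2 ∂vol + (∫⁻ x, ‖weakPartial 0 (fun x => u x j) x‖ₑ ^ 2 ∂vol +
      ∫⁻ x, ‖weakPartial 1 (fun x => u x j) x‖ₑ ^ 2 ∂vol) ≤ ENNReal.ofReal (h ^ 2) := by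
  have hwp : ∀ i, MemLp (weakPartial i (fun x => u x j)) 2 vol := fun i => by
    obtain ⟨g, hg, hg2⟩ := hu.2 i j
    exact (weakPartial_spec hg hg2).2
  have e := lintegral_enorm_pow_eq two_ne_zero (by exact_mod_cast hu.1)
  have e' := fun i => lintegral_enorm_pow_eq two_ne_zero (by exact_mod_cast hwp i)
  have h0 : ∫⁻ x, ‖u x j‖ₑ ^ 2 ∂vol ≤ ∫⁻ x, ‖u x‖ₑ ^ 2 ∂vol :=
    lintegral_mono fun x => pow_le_pow_left₀ zero_le
      (enorm_le_iff_norm_le.2 (PiLp.norm_apply_le (u x) j)) 2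
  have h1 : 0 ≤ normH1 u := Real.sqrt_nonneg _
  rw [e' 0, e' 1]
  rw [e] at h0
  refine (add_le_add h0 le_rfl).trans ?_
  rw [← ENNReal.ofReal_add (by positivity) (by positivity),
    ← ENNReal.ofReal_add (by positivity) (by positivity)]
  refine ENNReal.ofReal_le_ofReal (le_trans ?_ (pow_le_pow_left₀ h1 hh 2))
  rw [normH1_sq]
  simp only [Fin.sum_univ_two, Nat.cast_ofNat]
  fin_cases j <;> simp only [Fin.mk_zero, Fin.mk_one, Fin.isValue] <;>
    nlinarith [sq_nonneg (normLp 2 (weakPartial 0 (fun x => u x 0))),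
      sq_nonneg (normLp 2 (weakPartial 0 (fun x => u x 1))),
      sq_nonneg (normLp 2 (weakPartial 1 (fun x => u x 0))),
      sq_nonneg (normLp 2 (weakPartial 1 (fun x => u x 1)))]

end HalfPlane

theorem lemma2p3 (ρhat : ℝ) :
    ∃ C : ℝ, 0 < C ∧
      ∀ (ρ : HalfPlane.Plane → ℝ) (u : HalfPlane.Plane → HalfPlane.Plane),
        AEMeasurable ρ HalfPlane.vol →
        (∀ᵐ x ∂HalfPlane.vol, 0 ≤ ρ x ∧ ρ x ≤ ρhat) →
        HalfPlane.MemH1 u →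
        HalfPlane.SlipBoundary u →
        MemLp (fun x => Real.sqrt (ρ x) • u x) 4 HalfPlane.vol ∧
        HalfPlane.normLp 4 (fun x => Real.sqrt (ρ x) • u x) ^ 2 ≤
          C * (1 + HalfPlane.normLp 2 (fun x => Real.sqrt (ρ x) • u x)) * HalfPlane.normH1 u *
            Real.sqrt (Real.log (2 + HalfPlane.normH1 u ^ 2)) := by
  obtain ⟨K, hK⟩ := HalfPlane.exists_norm_fderiv_cutoff_le
  set c := 4 + 2 * K ^ 2 with hc
  have hc0 : 0 < c := by positivity
  -- A bound of at least $1$ is positive whatever the sign of `ρhat` and allows $R\le R^2$.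
  set R := max ρhat 1 with hR
  have hR1 : 1 ≤ R := le_max_right _ _
  have hR0 : 0 < R := by linarith
  refine ⟨√(1024 * c * R ^ 2), Real.sqrt_pos.2 (by positivity), fun ρ u hρm hρ hu _ => ?_⟩
  have hρR : ∀ᵐ x ∂HalfPlane.vol, 0 ≤ ρ x ∧ ρ x ≤ R := by
    filter_upwards [hρ] with x hx
    exact ⟨hx.1, hx.2.trans (le_max_left _ _)⟩
  set v : HalfPlane.Plane → HalfPlane.Plane := fun x => √(ρ x) • u x with hv
  have hvm : AEStronglyMeasurable v HalfPlane.vol :=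
    (Real.continuous_sqrt.measurable.comp_aemeasurable hρm).aestronglyMeasurable.smul hu.1.1
  have hv2 : MemLp v 2 HalfPlane.vol := by
    refine hu.1.of_le_mul (c := √R) hvm ?_
    filter_upwards [hρR] with x hx
    rw [hv, norm_smul, Real.norm_of_nonneg (Real.sqrt_nonneg _)]
    exact mul_le_mul_of_nonneg_right (Real.sqrt_le_sqrt hx.2) (norm_nonneg _)
  set V := HalfPlane.normLp 2 v with hV
  have hV0 : 0 ≤ V := ENNReal.toReal_nonneg
  set H := HalfPlane.normH1 u with hH
  have hH0 : 0 ≤ H := Real.sqrt_nonneg _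
  -- The level $t$ must be positive but $H$ may vanish; a strictly larger $h$ avoids the degenerate
  -- case, and the final bound follows by continuity as $h\downarrow H$.
  have key : ∀ h : ℝ, H < h → ∫⁻ x, ‖v x‖ₑ ^ 4 ∂HalfPlane.vol ≤
      ENNReal.ofReal (1024 * c * R ^ 2 * ((1 + V) ^ 2 * h ^ 2 * Real.log (2 + h ^ 2))) := by
    intro h hHh
    refine HalfPlane.lintegral_pow_four_le hc0 hR1 (hH0.trans_lt hHh) hρR hv2 hu.1.1
      fun j t N ht hN hNt => ?_
    have hwp : ∀ i, HalfPlane.HasWeakPartial i (fun x => u x j)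
        (HalfPlane.weakPartial i (fun x => u x j)) ∧
        MemLp (HalfPlane.weakPartial i (fun x => u x j)) 2 HalfPlane.vol := fun i => by
      obtain ⟨g, hg, hg2⟩ := hu.2 i j
      exact HalfPlane.weakPartial_spec hg hg2
    have huj : MemLp (fun x => u x j) 2 HalfPlane.vol := by
      refine hu.1.of_le ?_ (ae_of_all _ fun x => PiLp.norm_apply_le (u x) j)
      exact (show Continuous fun y : HalfPlane.Plane => y j by fun_prop).comp_aestronglyMeasurable
        hu.1.1
    exact HalfPlane.lintegral_excess_pow_four_le hK (fun i => (hwp i).1) huj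
      (fun i => (hwp i).2) ht (HalfPlane.lintegral_component_le hu j hHh.le) hN hNt
  have hv4 : MemLp v 4 HalfPlane.vol := by
    refine ⟨hvm, ?_⟩
    have hlt : eLpNorm v 4 HalfPlane.vol ^ 4 < ⊤ := by
      have h' : eLpNorm v 4 HalfPlane.vol ^ 4 = ∫⁻ x, ‖v x‖ₑ ^ 4 ∂HalfPlane.vol :=
        HalfPlane.eLpNorm_pow_eq_lintegral v four_ne_zero
      rw [h']
      exact (key (H + 1) (by linarith)).trans_lt ENNReal.ofReal_lt_top
    exact (ENNReal.pow_lt_top_iff.1 hlt).resolve_right (by norm_num)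
  refine ⟨hv4, ?_⟩
  have hbd : ∀ h : ℝ, H < h → HalfPlane.normLp 4 v ^ 2 ≤
      √(1024 * c * R ^ 2) * (1 + V) * h * √(Real.log (2 + h ^ 2)) := by
    intro h hHh
    have hh : 0 < h := hH0.trans_lt hHh
    have hL0 : 0 < Real.log (2 + h ^ 2) := Real.log_pos (by nlinarith)
    have e := HalfPlane.lintegral_enorm_pow_eq four_ne_zero (by exact_mod_cast hv4)
    have h1 := key h hHh
    rw [e, ENNReal.ofReal_le_ofReal_iff (by positivity)] at h1
    refine le_of_sq_le_sq ?_ (by positivity)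
    rw [mul_pow, mul_pow, mul_pow, Real.sq_sqrt (by positivity), Real.sq_sqrt hL0.le]
    calc (HalfPlane.normLp 4 v ^ 2) ^ 2 = HalfPlane.normLp 4 v ^ 4 := by ring
      _ ≤ _ := h1
      _ = _ := by ring
  have hcont : ContinuousAt (fun h : ℝ =>
      √(1024 * c * R ^ 2) * (1 + V) * h * √(Real.log (2 + h ^ 2))) H := by
    have hne : (2 : ℝ) + H ^ 2 ≠ 0 := by positivity
    fun_prop (disch := assumption)
  refine ge_of_tendsto (hcont.tendsto.mono_left (nhdsWithin_le_nhds (s := Set.Ioi H))) ?_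
  filter_upwards [self_mem_nhdsWithin] with h hh
  exact hbd h hh
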